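/- Let $\mathcal L$ be a collection of $n$ pairwise disjoint, simple, piecewise regular ($C^1$) open curves in $\mathbb R^3$ whose $2n$ endpoints carry the labels $E=\{1,\dots,2n\}$. Let $\tau\in S_{2n}$ be its strand permutation ($i$ and $\tau(i)$ label the two endpoints of the same curve) and let $\sigma\in S_{2n}$ be a closure permutation, i.e. $\sigma^2=\mathrm{id}$ and $\sigma(i)\neq i$ for all $i\in E$. A virtual closure $(\mathcal L_\tau,\sigma)_v$ of $\mathcal L$ in $3$-space is a link in $\mathbb R^3$ obtained from $\mathcal L$ by adding, for every pair $\{i,\sigma(i)\}$, a virtual arc joining the endpoints $i$ and $\sigma(i)$. In a projection, every crossing in which a virtual arc takes part is by convention a virtual crossing, while the crossings between curves of $\mathcal L$ are classical, the over-strand being the higher one in the direction of projection. For a linkoid diagram $L_\tau$ in a plane, with strand permutation $\tau$, a closure diagram of $L_\tau$ with respect to $\sigma$ is a virtual link diagram obtained from $L_\tau$ by adding, for every pair $\{i,\sigma(i)\}$, a closure arc from $i$ to $\sigma(i)$ all of whose crossings are virtual; the virtual closure $(L_\tau,\sigma)_v$ is the virtual link represented by such a diagram, virtual links being taken up to planar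 isotopy, generalized Reidemeister moves and detour moves. Let $\vec\xi\in S^2$ be such that the projections of $\mathcal L$ and of the chosen virtual closure $(\mathcal L_\tau,\sigma)_v$ to the plane with normal vector $\vec\xi$ are regular (their only singularities are finitely many transversal double points, away from the endpoints and corners). Let $\mathcal L_{\vec\xi}$ be the linkoid diagram obtained by projecting $\mathcal L$, and let $\big((\mathcal L_\tau,\sigma)_v\big)_{\vec\xi}$ be the virtual diagram obtained by projecting $(\mathcal L_\tau,\sigma)_v$. Then $$\big((\mathcal L_\tau,\sigma)_v\big)_{\vec\xi}=\big((\mathcal L_{\vec\xi})_\tau,\sigma\big)_v .$$ That is, the diagram $\big((\mathcal L_\tau,\sigma)_v\big)_{\vec\xi}$ is a closure diagram of $(\mathcal L_{\vec\xi})_\tau$ with respect to $\sigma$, and the virtual link which it represents is the virtual closure of $(\mathcal L_{\vec\xi})_\tau$ with respect to $\sigma$: every closure diagram of $(\mathcal L_{\vec\xi})_\tau$ with respect to $\sigma$, for any choice of the closure arcs, represents this same virtual link. -/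

import Mathlib

open Set Topology

/-! ## Piecewise regular arcs -/

/-- A curve parametrized by `[0, 1]` is piecewise regular if, away from finitely many break points,
it is continuously differentiable with nowhere vanishing derivative, up to and including the
one-sided derivatives at the break points. -/
def IsPiecewiseRegular {X : Type*} [NormedAddCommGroup X] [NormedSpace ℝ X] (γ : ℝ → X) : Prop :=
  ∃ T : Finset ℝ, ∀ a b : ℝ, 0 ≤ a → a < b → b ≤ 1 → (∀ t ∈ T, t ∉ Ioo a b) →
    ContDiffOn ℝ 1 γ (Icc a b) ∧ ∀ t ∈ Icc a b, derivWithin γ (Icc a b) t ≠ 0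

/-- A fixed point free involution. -/
def IsPairing {D : Type*} (e : Equiv.Perm D) : Prop :=
  (∀ d, e (e d) = d) ∧ ∀ d, e d ≠ d

/-! A finite system of arcs is described by oriented arcs `γ d : [0, 1] → X`, indexed by `d : D`,
where `rev d` is the index of the arc `d` with the opposite orientation, so that every arc occurs
exactly twice.  The permutation `glue` tells how arcs are joined: the starting point of `d` is
joined to the starting point of `glue d`.  If `glue` is a fixed point free involution, then
the arcs fit together to closed curves; if `glue = 1`, then nothing is joined and one has a
collection of open curves. -/

/-- The parameters `(d, s)` and `(d', t)` belong to the same point of the same arc. -/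
def SameParam {D : Type*} (rev : Equiv.Perm D) (d : D) (s : ℝ) (d' : D) (t : ℝ) : Prop :=
  (d' = d ∧ t = s) ∨ (d' = rev d ∧ t = 1 - s)

/-- Piecewise regular arcs which are joined at their end points as prescribed by `glue`,
and no end point of which lies on the interior of an arc. -/
structure IsArcSystem {D X : Type*} [NormedAddCommGroup X] [NormedSpace ℝ X]
    (rev glue : Equiv.Perm D) (γ : D → ℝ → X) : Prop where
  regular : ∀ d, IsPiecewiseRegular (γ d)
  reverse : ∀ d, ∀ t ∈ Icc (0 : ℝ) 1, γ (rev d) t = γ d (1 - t)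
  joint : ∀ d d', γ d 0 = γ d' 0 ↔ d' = d ∨ d' = glue d
  ends : ∀ d d', ∀ t ∈ Ioo (0 : ℝ) 1, γ d 0 ≠ γ d' t

/-- The arcs form embedded curves. -/
structure IsEmbeddedSystem {D X : Type*} [NormedAddCommGroup X] [NormedSpace ℝ X]
    (rev glue : Equiv.Perm D) (γ : D → ℝ → X) : Prop extends IsArcSystem rev glue γ where
  inj : ∀ d d', ∀ s ∈ Ioo (0 : ℝ) 1, ∀ t ∈ Ioo (0 : ℝ) 1, γ d s = γ d' t → SameParam rev d s d' t

/-- The curves `γ` at time `s` and `δ` at time `t` have linearly independent tangent vectors. -/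
def IsTransverse {X : Type*} [NormedAddCommGroup X] [NormedSpace ℝ X]
    (γ : ℝ → X) (s : ℝ) (δ : ℝ → X) (t : ℝ) : Prop :=
  ContDiffAt ℝ 1 γ s ∧ ContDiffAt ℝ 1 δ t ∧ LinearIndependent ℝ ![deriv γ s, deriv δ t]

/-- `p` is a crossing of the arcs `d` and `d'` (`d'` may be `d` or its reverse). -/
def IsCrossing {D X : Type*} (rev : Equiv.Perm D) (γ : D → ℝ → X) (d d' : D) (p : X) : Prop :=
  ∃ s ∈ Ioo (0 : ℝ) 1, ∃ t ∈ Ioo (0 : ℝ) 1,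
    γ d s = p ∧ γ d' t = p ∧ ¬ SameParam rev d s d' t

/-- The arcs form generic curves (to be used in a plane): their only singularities are finitely
many transversal double points. -/
structure IsGenericSystem {D P : Type*} [NormedAddCommGroup P] [NormedSpace ℝ P]
    (rev glue : Equiv.Perm D) (γ : D → ℝ → P) : Prop extends IsArcSystem rev glue γ where
  transverse : ∀ d d', ∀ s ∈ Ioo (0 : ℝ) 1, ∀ t ∈ Ioo (0 : ℝ) 1, γ d s = γ d' t →
    SameParam rev d s d' t ∨ IsTransverse (γ d) s (γ d') t
  no_triple : ∀ d₁ d₂ d₃, ∀ s₁ ∈ Ioo (0 : ℝ) 1, ∀ s₂ ∈ Ioo (0 : ℝ) 1, ∀ s₃ ∈ Ioo (0 : ℝ) 1,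
    γ d₁ s₁ = γ d₂ s₂ → γ d₁ s₁ = γ d₃ s₃ →
    SameParam rev d₁ s₁ d₂ s₂ ∨ SameParam rev d₁ s₁ d₃ s₃ ∨ SameParam rev d₂ s₂ d₃ s₃
  finite : {p | ∃ d d', IsCrossing rev γ d d' p}.Finite

/-- Crossing data on generic curves.  `(p, ℓ) ∈ classical` means that `p` is a classical crossing,
and `ℓ` is the tangent line of the over-strand there; `virt` is the set of virtual crossings. -/
structure IsCrossingData {D P : Type*} [NormedAddCommGroup P] [NormedSpace ℝ P]
    (rev : Equiv.Perm D) (γ : D → ℝ → P) (classical : Set (P × Submodule ℝ P)) (virt : Set P) :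
    Prop where
  crossing_iff : ∀ p, (∃ d d', IsCrossing rev γ d d' p) ↔ (∃ ℓ, (p, ℓ) ∈ classical) ∨ p ∈ virt
  not_both : ∀ p ℓ, (p, ℓ) ∈ classical → p ∉ virt
  over_unique : ∀ p ℓ ℓ', (p, ℓ) ∈ classical → (p, ℓ') ∈ classical → ℓ = ℓ'
  over_tangent : ∀ p ℓ, (p, ℓ) ∈ classical →
    ∃ d, ∃ s ∈ Ioo (0 : ℝ) 1, γ d s = p ∧ ℓ = Submodule.span ℝ {deriv (γ d) s}

/-! ## Linkoid diagrams and virtual link diagrams -/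

/-- The strand permutations and closure permutations of the endpoint labels `1, …, 2n`. -/
abbrev ClosurePerm (n : ℕ) : Type := {σ : Equiv.Perm (Fin (2 * n)) // IsPairing σ}

/-- A linkoid diagram in the plane `P` with `n` components and labelled endpoints, whose strand
permutation is `τ`.  The component with end points labelled `i` and `τ i` is parametrized from
`i` to `τ i` by `strand i`, and in the opposite direction by `strand (τ i)`. -/
structure LinkoidDiagram (P : Type*) [NormedAddCommGroup P] [NormedSpace ℝ P] {n : ℕ}
    (τ : ClosurePerm n) where
  strand : Fin (2 * n) → ℝ → P
  classical : Set (P × Submodule ℝ P)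
  generic : IsGenericSystem τ.1 1 strand
  crossingData : IsCrossingData τ.1 strand classical ∅

/-- The closed curves `γ` trace out `carrier`, with the given crossing data. -/
structure IsPresentation {D P : Type*} [NormedAddCommGroup P] [NormedSpace ℝ P]
    (rev glue : Equiv.Perm D) (γ : D → ℝ → P)
    (carrier : Set P) (classical : Set (P × Submodule ℝ P)) (virt : Set P) : Prop where
  pairing_rev : IsPairing rev
  pairing_glue : IsPairing glue
  generic : IsGenericSystem rev glue γ
  carrier_eq : carrier = ⋃ d, γ d '' Icc 0 1
  crossingData : IsCrossingData rev γ classical virt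

/-- A virtual (knot or link) diagram in the plane `P`: the (unoriented) image of generic closed
curves, each crossing of which is marked as classical (with over/under information) or virtual. -/
structure VirtualDiagram (P : Type*) [NormedAddCommGroup P] [NormedSpace ℝ P] where
  carrier : Set P
  classical : Set (P × Submodule ℝ P)
  virt : Set P
  exists_curves : ∃ (D : Type) (_ : Finite D) (rev glue : Equiv.Perm D) (γ : D → ℝ → P),
    IsPresentation rev glue γ carrier classical virt

/-! ## Moves on virtual diagrams and virtual links -/

/-- A diffeomorphism of class `C¹`. -/
def IsC1Diffeo {X Y : Type*} [NormedAddCommGroup X] [NormedSpace ℝ X] [NormedAddCommGroup Y]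
    [NormedSpace ℝ Y] (φ : X ≃ₜ Y) : Prop :=
  ContDiff ℝ 1 φ ∧ ContDiff ℝ 1 φ.symm

/-- The image under `φ` of classical crossings with the tangent lines of their over-strands. -/
def pushClassical {X Y : Type*} [NormedAddCommGroup X] [NormedSpace ℝ X] [NormedAddCommGroup Y]
    [NormedSpace ℝ Y] (φ : X → Y) (C : Set (X × Submodule ℝ X)) : Set (Y × Submodule ℝ Y) :=
  (fun c => (φ c.1, c.2.map (fderiv ℝ φ c.1 : X →ₗ[ℝ] Y))) '' C

/-- `D'` is the image of `D` under an ambient isotopy of the plane. -/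
def IsIsotopic {P : Type*} [NormedAddCommGroup P] [NormedSpace ℝ P] (D D' : VirtualDiagram P) :
    Prop :=
  ∃ H : ℝ → P ≃ₜ P, Continuous (fun x : ℝ × P => H x.1 x.2) ∧
    (∀ t ∈ Icc (0 : ℝ) 1, IsC1Diffeo (H t)) ∧ H 0 = Homeomorph.refl P ∧
    D'.carrier = H 1 '' D.carrier ∧ D'.virt = H 1 '' D.virt ∧
    D'.classical = pushClassical (H 1) D.classical

/-- A piece of a virtual diagram in the square `[-3, 3]²`. -/
structure LocalPicture where
  carrier : Set (ℝ × ℝ)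
  classical : Set ((ℝ × ℝ) × Submodule ℝ (ℝ × ℝ))
  virt : Set (ℝ × ℝ)

/-- The square containing the local pictures. -/
def pictureBox : Set (ℝ × ℝ) := Icc (-3) 3 ×ˢ Icc (-3) 3

/-- The part of `D` in the disc `φ([-3, 3]²)` is the image under `φ` of the picture `A`. -/
structure ShowsPicture {P : Type*} [NormedAddCommGroup P] [NormedSpace ℝ P]
    (D : VirtualDiagram P) (φ : (ℝ × ℝ) ≃ₜ P) (A : LocalPicture) : Prop where
  carrier_eq : D.carrier ∩ φ '' pictureBox = φ '' A.carrier
  classical_eq : {c ∈ D.classical | c.1 ∈ φ '' pictureBox} = pushClassical φ A.classical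
  virt_eq : D.virt ∩ φ '' pictureBox = φ '' A.virt

/-- Inside a disc, `D` shows the picture `A` and `D'` shows the picture `A'`; outside of that
disc, `D` and `D'` agree. -/
def IsLocalMove {P : Type*} [NormedAddCommGroup P] [NormedSpace ℝ P] (A A' : LocalPicture)
    (D D' : VirtualDiagram P) : Prop :=
  ∃ φ : (ℝ × ℝ) ≃ₜ P, IsC1Diffeo φ ∧ ShowsPicture D φ A ∧ ShowsPicture D' φ A' ∧
    D.carrier \ φ '' pictureBox = D'.carrier \ φ '' pictureBox ∧
    {c ∈ D.classical | c.1 ∉ φ '' pictureBox} = {c ∈ D'.classical | c.1 ∉ φ '' pictureBox} ∧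
    D.virt \ φ '' pictureBox = D'.virt \ φ '' pictureBox

/-- The line through the origin spanned by `(x, y)`. -/
def dirLine (x y : ℝ) : Submodule ℝ (ℝ × ℝ) := Submodule.span ℝ {(x, y)}

/-- The horizontal strand through the centre of the square. -/
def horizontalStrand : Set (ℝ × ℝ) := segment ℝ (-3, 0) (3, 0)

/-- A strand with a kink: it crosses itself at the origin, where one passage is horizontal and the
other one is vertical. -/
def kinkStrand : Set (ℝ × ℝ) :=
  segment ℝ (-3, 0) (1, 0) ∪ segment ℝ (1, 0) (1, 1) ∪ segment ℝ (1, 1) (0, 1) ∪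
    segment ℝ (0, 1) (0, -1) ∪ segment ℝ (0, -1) (2, -1) ∪ segment ℝ (2, -1) (2, 0) ∪
    segment ℝ (2, 0) (3, 0)

/-- The strand from `(-3, a)` to `(3, a)` with a corner at `(0, b)`. -/
def bentStrand (a b : ℝ) : Set (ℝ × ℝ) := segment ℝ (-3, a) (0, b) ∪ segment ℝ (0, b) (3, a)

/-- The two diagonals of the square. -/
def diagonalStrands : Set (ℝ × ℝ) := segment ℝ (-3, -3) (3, 3) ∪ segment ℝ (-3, 3) (3, -3)

/-- The pairs of local pictures of the generalized Reidemeister moves: the classical moves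
`R1`, `R2`, `R3`, the virtual moves `V1`, `V2`, `V3` and the semi-virtual move `SV`. -/
inductive ReidemeisterPictures : LocalPicture → LocalPicture → Prop
  /-- A classical kink is removed; the over-strand is the horizontal or the vertical passage. -/
  | R1 (ℓ : Submodule ℝ (ℝ × ℝ)) (hℓ : ℓ = dirLine 1 0 ∨ ℓ = dirLine 0 1) :
      ReidemeisterPictures ⟨kinkStrand, {((0, 0), ℓ)}, ∅⟩ ⟨horizontalStrand, ∅, ∅⟩
  /-- A virtual kink is removed. -/
  | V1 : ReidemeisterPictures ⟨kinkStrand, ∅, {(0, 0)}⟩ ⟨horizontalStrand, ∅, ∅⟩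
  /-- The horizontal strand passes over the bent strand twice. -/
  | R2_over : ReidemeisterPictures
      ⟨horizontalStrand ∪ bentStrand 2 (-1), {((-1, 0), dirLine 1 0), ((1, 0), dirLine 1 0)}, ∅⟩
      ⟨horizontalStrand ∪ bentStrand 2 1, ∅, ∅⟩
  /-- The bent strand passes over the horizontal strand twice. -/
  | R2_under : ReidemeisterPictures
      ⟨horizontalStrand ∪ bentStrand 2 (-1),
        {((-1, 0), dirLine 1 (-1)), ((1, 0), dirLine 1 1)}, ∅⟩
      ⟨horizontalStrand ∪ bentStrand 2 1, ∅, ∅⟩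
  | V2 : ReidemeisterPictures
      ⟨horizontalStrand ∪ bentStrand 2 (-1), ∅, {(-1, 0), (1, 0)}⟩
      ⟨horizontalStrand ∪ bentStrand 2 1, ∅, ∅⟩
  /-- The bent strand is moved across the crossing of the two diagonals.  The three strands lie at
  pairwise different levels `a` (rising diagonal), `b` (falling diagonal), `c` (bent strand). -/
  | R3 (a b c : ℕ) (hab : a ≠ b) (hac : a ≠ c) (hbc : b ≠ c) : ReidemeisterPictures
      ⟨diagonalStrands ∪ bentStrand 0 (3 / 2),
        {((0, 0), if b < a then dirLine 1 1 else dirLine 1 (-1)),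
          ((1, 1), if c < a then dirLine 1 1 else dirLine 2 (-1)),
          ((-1, 1), if c < b then dirLine 1 (-1) else dirLine 2 1)}, ∅⟩
      ⟨diagonalStrands ∪ bentStrand 0 (-(3 / 2)),
        {((0, 0), if b < a then dirLine 1 1 else dirLine 1 (-1)),
          ((-1, -1), if c < a then dirLine 1 1 else dirLine 2 (-1)),
          ((1, -1), if c < b then dirLine 1 (-1) else dirLine 2 1)}, ∅⟩
  | V3 : ReidemeisterPictures
      ⟨diagonalStrands ∪ bentStrand 0 (3 / 2), ∅, {(0, 0), (1, 1), (-1, 1)}⟩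
      ⟨diagonalStrands ∪ bentStrand 0 (-(3 / 2)), ∅, {(0, 0), (-1, -1), (1, -1)}⟩
  /-- A strand with virtual crossings is moved across a classical crossing. -/
  | SV (ℓ : Submodule ℝ (ℝ × ℝ)) (hℓ : ℓ = dirLine 1 1 ∨ ℓ = dirLine 1 (-1)) :
      ReidemeisterPictures
      ⟨diagonalStrands ∪ bentStrand 0 (3 / 2), {((0, 0), ℓ)}, {(1, 1), (-1, 1)}⟩
      ⟨diagonalStrands ∪ bentStrand 0 (-(3 / 2)), {((0, 0), ℓ)}, {(-1, -1), (1, -1)}⟩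

/-- A detour move: one arc `d₀` of `D`, without classical crossings, is excised and replaced by
another arc with the same end points, all of whose crossings are again virtual.  Nothing else is
changed. -/
def IsDetour {P : Type*} [NormedAddCommGroup P] [NormedSpace ℝ P] (D D' : VirtualDiagram P) :
    Prop :=
  ∃ (A : Type) (_ : Finite A) (rev glue : Equiv.Perm A) (γ γ' : A → ℝ → P) (d₀ : A),
    IsPresentation rev glue γ D.carrier D.classical D.virt ∧
    IsPresentation rev glue γ' D'.carrier D'.classical D'.virt ∧
    (∀ d, d ≠ d₀ → d ≠ rev d₀ → ∀ t ∈ Icc (0 : ℝ) 1, γ' d t = γ d t) ∧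
    γ' d₀ 0 = γ d₀ 0 ∧ γ' d₀ 1 = γ d₀ 1 ∧
    D'.classical = D.classical ∧
    (∀ d p, IsCrossing rev γ d₀ d p → p ∈ D.virt) ∧
    (∀ d p, IsCrossing rev γ' d₀ d p → p ∈ D'.virt)

/-- The moves which generate the equivalence of virtual diagrams. -/
inductive VirtualMove {P : Type*} [NormedAddCommGroup P] [NormedSpace ℝ P] :
    VirtualDiagram P → VirtualDiagram P → Prop
  | isotopy {D D'} (h : IsIsotopic D D') : VirtualMove D D'
  | reidemeister {D D'} (A A' : LocalPicture) (hA : ReidemeisterPictures A A')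
      (h : IsLocalMove A A' D D') : VirtualMove D D'
  | detour {D D'} (h : IsDetour D D') : VirtualMove D D'

/-- Virtual knots and links: virtual diagrams up to the equivalence relation generated by
the moves. -/
def VirtualLink (P : Type*) [NormedAddCommGroup P] [NormedSpace ℝ P] : Type _ :=
  Quot (VirtualMove (P := P))

/-- The virtual link represented by a diagram. -/
def VirtualDiagram.link {P : Type*} [NormedAddCommGroup P] [NormedSpace ℝ P]
    (D : VirtualDiagram P) : VirtualLink P :=
  Quot.mk _ D

/-! ## The virtual closure of a linkoid diagram -/

/-- The orientation reversal for `n` strands with strand permutation `τ`, together with `n`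
closure arcs with closure permutation `σ`. -/
abbrev closureRev {n : ℕ} (τ σ : ClosurePerm n) : Equiv.Perm (Fin (2 * n) ⊕ Fin (2 * n)) :=
  Equiv.Perm.sumCongr τ.1 σ.1

/-- The strand and the closure arc which start at `i` are joined there. -/
abbrev closureGlue (n : ℕ) : Equiv.Perm (Fin (2 * n) ⊕ Fin (2 * n)) :=
  Equiv.sumComm _ _

/-- The diagram `D` is obtained from the linkoid diagram `L` by introducing, for every `i`, a
closure arc from `i` to `σ i` (the arc for `σ i` being the same arc with the opposite orientation)
all of whose crossings are virtual. -/
def LinkoidDiagram.IsClosureDiagram {P : Type*} [NormedAddCommGroup P] [NormedSpace ℝ P] {n : ℕ}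
    {τ : ClosurePerm n} (L : LinkoidDiagram P τ) (σ : ClosurePerm n) (D : VirtualDiagram P) :
    Prop :=
  ∃ arc : Fin (2 * n) → ℝ → P,
    IsGenericSystem (closureRev τ σ) (closureGlue n) (Sum.elim L.strand arc) ∧
    D.carrier = (⋃ i, L.strand i '' Icc 0 1) ∪ ⋃ i, arc i '' Icc 0 1 ∧
    D.classical = L.classical ∧
    D.virt = {p | ∃ i d, IsCrossing (closureRev τ σ) (Sum.elim L.strand arc) (Sum.inr i) d p}

/-- `V` is the virtual closure of `L` with respect to `σ`: it is the virtual link which is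
obtained by introducing closure arcs, whatever the choice of these arcs. -/
def LinkoidDiagram.IsVirtualClosure {P : Type*} [NormedAddCommGroup P] [NormedSpace ℝ P] {n : ℕ}
    {τ : ClosurePerm n} (L : LinkoidDiagram P τ) (σ : ClosurePerm n) (V : VirtualLink P) : Prop :=
  (∃ D, L.IsClosureDiagram σ D ∧ D.link = V) ∧ ∀ D, L.IsClosureDiagram σ D → D.link = V

/-! ## Auxiliary facts about crossings -/

theorem SameParam.symm {D : Type*} {rev : Equiv.Perm D} (hr : IsPairing rev) {d d' : D} {s t : ℝ}
    (h : SameParam rev d s d' t) : SameParam rev d' t d s := by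
  rcases h with ⟨rfl, rfl⟩ | ⟨rfl, rfl⟩
  · exact Or.inl ⟨rfl, rfl⟩
  · exact Or.inr ⟨(hr.1 d).symm, by ring⟩

theorem SameParam.apply_eq {D X : Type*} {rev : Equiv.Perm D} {γ : D → ℝ → X}
    (hγ : ∀ d, ∀ t ∈ Icc (0 : ℝ) 1, γ (rev d) t = γ d (1 - t)) {d d' : D} {s t : ℝ}
    (hs : s ∈ Ioo (0 : ℝ) 1) (h : SameParam rev d s d' t) : γ d' t = γ d s := by
  rcases h with ⟨rfl, rfl⟩ | ⟨rfl, rfl⟩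
  · rfl
  · rw [hγ d (1 - s) ⟨by linarith [hs.2], by linarith [hs.1]⟩]
    congr 1
    ring

theorem SameParam.span_deriv {D X : Type*} [NormedAddCommGroup X] [NormedSpace ℝ X]
    {rev : Equiv.Perm D} {γ : D → ℝ → X}
    (hγ : ∀ d, ∀ t ∈ Icc (0 : ℝ) 1, γ (rev d) t = γ d (1 - t)) {d d' : D} {s t : ℝ}
    (hs : s ∈ Ioo (0 : ℝ) 1) (h : SameParam rev d s d' t) :
    Submodule.span ℝ {deriv (γ d') t} = Submodule.span ℝ {deriv (γ d) s} := by
  rcases h with ⟨rfl, rfl⟩ | ⟨rfl, rfl⟩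
  · rfl
  · have hmem : Icc (0 : ℝ) 1 ∈ 𝓝 (1 - s) :=
      Icc_mem_nhds (by linarith [hs.2]) (by linarith [hs.1])
    have he : γ (rev d) =ᶠ[𝓝 (1 - s)] fun t => γ d (1 - t) := by
      filter_upwards [hmem] with t ht using hγ d t ht
    rw [he.deriv_eq, deriv_comp_const_sub (f := γ d)]
    rw [show (1 : ℝ) - (1 - s) = s by ring, ← Set.neg_singleton, Submodule.span_neg]

/-! ## Open curves in space -/

/-- Euclidean 3-space. -/
abbrev Space : Type := EuclideanSpace ℝ (Fin 3)

/-- Directions of projection. -/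
abbrev Direction : Type := Metric.sphere (0 : Space) 1

/-- The plane with normal vector `ξ`. -/
noncomputable abbrev normalPlane (ξ : Direction) : Submodule ℝ Space := (Submodule.span ℝ {(ξ : Space)})ᗮ

/-- The orthogonal projection along `ξ`. -/
noncomputable def projAlong (ξ : Direction) (x : Space) : normalPlane ξ :=
  (normalPlane ξ).orthogonalProjectionOnto x

/-- The height above the plane with normal vector `ξ`. -/
noncomputable def heightAlong (ξ : Direction) (x : Space) : ℝ := inner ℝ (ξ : Space) x

theorem eq_of_proj_of_height (ξ : Direction) {x y : Space} (h : projAlong ξ x = projAlong ξ y)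
    (h' : heightAlong ξ x = heightAlong ξ y) : x = y := by
  have h1 : x - y ∈ Submodule.span ℝ {(ξ : Space)} := by
    have : (normalPlane ξ).orthogonalProjectionOnto (x - y) = 0 := by
      rw [map_sub, sub_eq_zero]; exact h
    rw [Submodule.orthogonalProjectionOnto_eq_zero_iff, Submodule.orthogonal_orthogonal] at this
    exact this
  have h2 : x - y ∈ (Submodule.span ℝ {(ξ : Space)})ᗮ := by
    rw [Submodule.mem_orthogonal_singleton_iff_inner_right, inner_sub_right, sub_eq_zero]
    exact h'
  have h3 := Submodule.inner_right_of_mem_orthogonal h1 h2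
  exact sub_eq_zero.1 (inner_self_eq_zero.1 h3)

/-- A collection of `n` disjoint open curves in space with labelled endpoints, whose strand
permutation is `τ`.  The curve with end points labelled `i` and `τ i` is parametrized from `i` to
`τ i` by `strand i`, and in the opposite direction by `strand (τ i)`. -/
structure OpenCurves {n : ℕ} (τ : ClosurePerm n) where
  strand : Fin (2 * n) → ℝ → Space
  embedded : IsEmbeddedSystem τ.1 1 strand

/-- The projection along `ξ` is regular. -/
def OpenCurves.IsRegular {n : ℕ} {τ : ClosurePerm n} (L : OpenCurves τ) (ξ : Direction) : Prop :=
  IsGenericSystem τ.1 1 (fun i t => projAlong ξ (L.strand i t))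

/-- The crossings in the projection along `ξ`; the over-strand is the one with the larger
height. -/
def OpenCurves.projClassical {n : ℕ} {τ : ClosurePerm n} (L : OpenCurves τ) (ξ : Direction) :
    Set (normalPlane ξ × Submodule ℝ (normalPlane ξ)) :=
  {c | ∃ i j, ∃ s ∈ Ioo (0 : ℝ) 1, ∃ t ∈ Ioo (0 : ℝ) 1,
    projAlong ξ (L.strand i s) = c.1 ∧ projAlong ξ (L.strand j t) = c.1 ∧
    heightAlong ξ (L.strand j t) < heightAlong ξ (L.strand i s) ∧
    c.2 = Submodule.span ℝ {deriv (fun u => projAlong ξ (L.strand i u)) s}}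

theorem OpenCurves.projClassical_crossingData {n : ℕ} {τ : ClosurePerm n} (L : OpenCurves τ)
    (ξ : Direction) (h : L.IsRegular ξ) :
    IsCrossingData τ.1 (fun i t => projAlong ξ (L.strand i t)) (L.projClassical ξ) ∅ := by
  have hrev := L.embedded.reverse
  refine ⟨?_, fun _ _ _ => id, ?_, ?_⟩
  · intro p
    constructor
    · rintro ⟨i, j, s, hs, t, ht, hp, hq, hne⟩
      refine Or.inl ?_
      have hhe : heightAlong ξ (L.strand i s) ≠ heightAlong ξ (L.strand j t) := fun hh =>
        hne (L.embedded.inj i j s hs t ht (eq_of_proj_of_height ξ (hp.trans hq.symm) hh))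
      rcases lt_or_gt_of_ne hhe with hlt | hlt
      · exact ⟨_, j, i, t, ht, s, hs, hq, hp, hlt, rfl⟩
      · exact ⟨_, i, j, s, hs, t, ht, hp, hq, hlt, rfl⟩
    · rintro (⟨ℓ, i, j, s, hs, t, ht, hp, hq, hlt, -⟩ | hv)
      · refine ⟨i, j, s, hs, t, ht, hp, hq, fun hsame => ?_⟩
        rw [hsame.apply_eq hrev hs] at hlt
        exact lt_irrefl _ hlt
      · exact hv.elim
  · rintro p ℓ ℓ' ⟨i, j, s, hs, t, ht, hp, hq, hlt, hℓ⟩ ⟨i', j', s', hs', t', ht', hp', hq', hlt', hℓ'⟩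
    simp only at hℓ hℓ' hp hq hp' hq'
    rw [hℓ, hℓ']
    have no1 : ¬ SameParam τ.1 i s j t := fun hsame => by
      rw [hsame.apply_eq hrev hs] at hlt
      exact lt_irrefl _ hlt
    have no2 : ¬ SameParam τ.1 i' s' j' t' := fun hsame => by
      rw [hsame.apply_eq hrev hs'] at hlt'
      exact lt_irrefl _ hlt'
    rcases h.no_triple i j i' s hs t ht s' hs' (hp.trans hq.symm) (hp.trans hp'.symm) with
      hc | hc | hc
    · exact (no1 hc).elim
    · exact (hc.span_deriv (γ := fun i t => projAlong ξ (L.strand i t)) h.reverse hs).symm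
    · rcases h.no_triple i j j' s hs t ht t' ht' (hp.trans hq.symm) (hp.trans hq'.symm) with
        hd | hd | hd
      · exact (no1 hd).elim
      · rw [hc.apply_eq hrev ht, hd.apply_eq hrev hs] at hlt'
        exact (lt_asymm hlt hlt').elim
      · rw [hc.apply_eq hrev ht, hd.apply_eq hrev ht] at hlt'
        exact (lt_irrefl _ hlt').elim
  · rintro p ℓ ⟨i, j, s, hs, t, ht, hp, hq, hlt, hℓ⟩
    exact ⟨i, s, hs, hp, hℓ⟩

/-- The linkoid diagram which is obtained by a regular projection along `ξ`. -/
noncomputable def OpenCurves.projection {n : ℕ} {τ : ClosurePerm n} (L : OpenCurves τ) (ξ : Direction)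
    (h : L.IsRegular ξ) : LinkoidDiagram (normalPlane ξ) τ where
  strand i t := projAlong ξ (L.strand i t)
  classical := L.projClassical ξ
  generic := h
  crossingData := L.projClassical_crossingData ξ h

/-- A virtual closure in space of the open curves `L` with respect to `σ`: for every `i`, a virtual
closure arc from `i` to `σ i` (the arc for `σ i` being the same arc with the opposite
orientation), such that the curves and the arcs together form a link in space. -/
structure SpaceClosure {n : ℕ} {τ : ClosurePerm n} (L : OpenCurves τ) (σ : ClosurePerm n) where
  arc : Fin (2 * n) → ℝ → Space
  embedded : IsEmbeddedSystem (closureRev τ σ) (closureGlue n) (Sum.elim L.strand arc)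

namespace SpaceClosure

variable {n : ℕ} {τ σ : ClosurePerm n} {L : OpenCurves τ}

/-- The projections along `ξ` of the curves and of the virtual arcs. -/
noncomputable def projCurve (K : SpaceClosure L σ) (ξ : Direction) :
    Fin (2 * n) ⊕ Fin (2 * n) → ℝ → normalPlane ξ :=
  fun d t => projAlong ξ (Sum.elim L.strand K.arc d t)

/-- The projection along `ξ` is regular. -/
def IsRegular (K : SpaceClosure L σ) (ξ : Direction) : Prop :=
  IsGenericSystem (closureRev τ σ) (closureGlue n) (K.projCurve ξ)

theorem sameParam_inl_iff {i j : Fin (2 * n)} {s t : ℝ} :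
    SameParam (closureRev τ σ) (Sum.inl i) s (Sum.inl j) t ↔ SameParam τ.1 i s j t := by
  simp [SameParam]

theorem isCrossing_inl_iff (K : SpaceClosure L σ) (ξ : Direction) {i j : Fin (2 * n)}
    {p : normalPlane ξ} :
    IsCrossing (closureRev τ σ) (K.projCurve ξ) (Sum.inl i) (Sum.inl j) p ↔
      IsCrossing τ.1 (fun i t => projAlong ξ (L.strand i t)) i j p := by
  simp only [IsCrossing, sameParam_inl_iff, projCurve, Sum.elim_inl]

theorem IsRegular.strands {K : SpaceClosure L σ} {ξ : Direction} (h : K.IsRegular ξ) :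
    L.IsRegular ξ where
  regular i := h.regular (Sum.inl i)
  reverse i := h.reverse (Sum.inl i)
  joint i j := by
    have := h.joint (Sum.inl i) (Sum.inl j)
    simpa [projCurve] using this
  ends i j := h.ends (Sum.inl i) (Sum.inl j)
  transverse i j s hs t ht he := by
    have := h.transverse (Sum.inl i) (Sum.inl j) s hs t ht he
    rwa [sameParam_inl_iff] at this
  no_triple i j k s hs t ht u hu h1 h2 := by
    have := h.no_triple (Sum.inl i) (Sum.inl j) (Sum.inl k) s hs t ht u hu h1 h2
    rwa [sameParam_inl_iff, sameParam_inl_iff, sameParam_inl_iff] at this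
  finite := h.finite.subset (by
    rintro p ⟨i, j, hp⟩
    exact ⟨Sum.inl i, Sum.inl j, (K.isCrossing_inl_iff ξ).2 hp⟩)

theorem pairing_closureRev (τ σ : ClosurePerm n) : IsPairing (closureRev τ σ) := by
  refine ⟨?_, ?_⟩
  · rintro (i | i)
    · simp [τ.2.1 i]
    · simp [σ.2.1 i]
  · rintro (i | i)
    · simpa using τ.2.2 i
    · simpa using σ.2.2 i

theorem pairing_closureGlue (n : ℕ) : IsPairing (closureGlue n) := by
  refine ⟨?_, ?_⟩ <;> rintro (i | i) <;> simp

theorem projection_crossingData (K : SpaceClosure L σ) (ξ : Direction) (h : K.IsRegular ξ) :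
    IsCrossingData (closureRev τ σ) (K.projCurve ξ) (L.projClassical ξ)
      {p | ∃ i d, IsCrossing (closureRev τ σ) (K.projCurve ξ) (Sum.inr i) d p} := by
  have hL := L.projClassical_crossingData ξ h.strands
  refine ⟨?_, ?_, hL.over_unique, ?_⟩
  · intro p
    have hp := hL.crossing_iff p
    simp only [mem_empty_iff_false, or_false] at hp
    rw [← hp]
    constructor
    · rintro ⟨i | i, j | j, hc⟩
      · exact Or.inl ⟨i, j, (K.isCrossing_inl_iff ξ).1 hc⟩
      · obtain ⟨s, hs, t, ht, h1, h2, h3⟩ := hc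
        exact Or.inr ⟨j, Sum.inl i, t, ht, s, hs, h2, h1,
          fun h4 => h3 (h4.symm (pairing_closureRev τ σ))⟩
      · exact Or.inr ⟨i, _, hc⟩
      · exact Or.inr ⟨i, _, hc⟩
    · rintro (⟨i, j, hc⟩ | ⟨i, d, hc⟩)
      · exact ⟨_, _, (K.isCrossing_inl_iff ξ).2 hc⟩
      · exact ⟨_, _, hc⟩
  · rintro p ℓ hc ⟨k, -, u, hu, -, -, h3, -, -⟩
    obtain ⟨i, j, s, hs, t, ht, h1, h2, hne⟩ := (hL.crossing_iff p).2 (Or.inl ⟨ℓ, hc⟩)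
    rcases h.no_triple (Sum.inl i) (Sum.inl j) (Sum.inr k) s hs t ht u hu (h1.trans h2.symm)
      (h1.trans h3.symm) with hd | hd | hd
    · exact hne (sameParam_inl_iff.1 hd)
    · simp [SameParam] at hd
    · simp [SameParam] at hd
  · intro p ℓ hc
    obtain ⟨i, s, hs, h1, h2⟩ := hL.over_tangent p ℓ hc
    exact ⟨Sum.inl i, s, hs, h1, h2⟩

/-- The virtual diagram which is obtained by a regular projection along `ξ`: the crossings between
curves of `L` are classical, where the over-strand is the one with the larger height, and all
crossings which involve a virtual arc are virtual. -/
noncomputable def projection (K : SpaceClosure L σ) (ξ : Direction) (h : K.IsRegular ξ) :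
    VirtualDiagram (normalPlane ξ) where
  carrier := ⋃ d, K.projCurve ξ d '' Icc 0 1
  classical := L.projClassical ξ
  virt := {p | ∃ i d, IsCrossing (closureRev τ σ) (K.projCurve ξ) (Sum.inr i) d p}
  exists_curves := ⟨Fin (2 * n) ⊕ Fin (2 * n), inferInstance, closureRev τ σ, closureGlue n,
    K.projCurve ξ, pairing_closureRev τ σ, pairing_closureGlue n, h, rfl,
    K.projection_crossingData ξ h⟩

end SpaceClosure

/-! That the projected link is a closure diagram is a matter of unfolding: the projected virtual
arcs serve as closure arcs, and on both sides the classical crossings are those of the projected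
strands and the virtual ones those involving an arc (`SpaceClosure.isClosureDiagram_projection`).

The substance is that any two closure diagrams of one linkoid diagram represent the same virtual
link. A detour move exchanges one closure arc for another with the same end points, so one would
like to exchange the arcs one at a time. The obstacle is genericity: an old arc and a new one may be
tangent, overlap or create triple points, so a mixed system need not be a diagram. The way out is to
route both diagrams through a common third arc. The arc at the label `i` is replaced in both by the
same broken line from its start `p` through a corner `m` to its end `q`, which costs one detour on
each side. Afterwards the two diagrams agree at `i` and at `σ i`; induction over the labels makes
them coincide (`link_closure_eq_of_eqOn_compl`).

It remains to find `m` in general position to both systems at once. Each requirement on `m` (not on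
an arc, not on a line through `p` or `q` that is tangent to an arc or passes through a corner, a
crossing or another end point, not collinear with `p` and `q`) excludes only a null set. For tangent
lines this is Sard's theorem for a map of the plane ruled by lines (`ae_ne_of_ruled_critical`).
Almost every `m` is therefore good for one system (`IsGenericSystem.ae_isGoodCorner`), hence some
`m` is good for both (`exists_common_replaceArc`), and a good corner keeps the system generic
(`IsGenericSystem.replaceArc`). -/

/-! ## Null sets in the plane -/

open MeasureTheory in
/-- A form of Sard's theorem: almost no point of the plane is a critical value of the ruled map
`(t, r) ↦ a t + r • b t`. -/
theorem ae_ne_of_ruled_critical (U : Set ℝ) (a b a' b' : ℝ → ℝ × ℝ)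
    (ha : ∀ t ∈ U, HasDerivAt a (a' t) t) (hb : ∀ t ∈ U, HasDerivAt b (b' t) t) :
    ∀ᵐ x : ℝ × ℝ, ∀ t ∈ U, ∀ r : ℝ,
      (a' t + r • b' t).1 * (b t).2 - (a' t + r • b' t).2 * (b t).1 = 0 → x ≠ a t + r • b t := by
  let f : ℝ × ℝ → ℝ × ℝ := fun y => a y.1 + y.2 • b y.1
  let f' : ℝ × ℝ → (ℝ × ℝ) →L[ℝ] (ℝ × ℝ) := fun y =>
    (ContinuousLinearMap.fst ℝ ℝ ℝ).smulRight (a' y.1 + y.2 • b' y.1) +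
      (ContinuousLinearMap.snd ℝ ℝ ℝ).smulRight (b y.1)
  -- The expression is the Jacobian determinant of `f`, whose partial derivatives are `a' t + r • b'
  -- t` and `b t`. Source and target have equal dimension, so differentiability alone makes the
  -- image of the critical set null.
  let s : Set (ℝ × ℝ) := {y | y.1 ∈ U ∧
    (a' y.1 + y.2 • b' y.1).1 * (b y.1).2 - (a' y.1 + y.2 • b' y.1).2 * (b y.1).1 = 0}
  have hf : ∀ y ∈ s, HasFDerivWithinAt f (f' y) s y := by
    intro y hy
    have h1 : HasFDerivAt (fun y : ℝ × ℝ => a y.1) _ y :=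
      (ha y.1 hy.1).hasFDerivAt.comp y (hasFDerivAt_fst (𝕜 := ℝ))
    have h2 : HasFDerivAt (fun y : ℝ × ℝ => b y.1) _ y :=
      (hb y.1 hy.1).hasFDerivAt.comp y (hasFDerivAt_fst (𝕜 := ℝ))
    have h3 := h1.add ((hasFDerivAt_snd (𝕜 := ℝ) (p := y)).smul h2)
    refine (h3.congr_fderiv ?_).hasFDerivWithinAt
    ext <;> simp [f']
  have hdet : ∀ y ∈ s, (f' y).det = 0 := by
    intro y hy
    rw [ContinuousLinearMap.det, ← LinearMap.det_toMatrix (Module.Basis.finTwoProd ℝ),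
      Matrix.det_fin_two]
    simp only [LinearMap.toMatrix_apply, Module.Basis.finTwoProd_zero,
      Module.Basis.finTwoProd_one, Module.Basis.coe_finTwoProd_repr]
    have := hy.2
    simp only [Prod.fst_add, Prod.smul_fst, Prod.snd_add, Prod.smul_snd, smul_eq_mul] at this
    simp [f']
    linarith
  have h0 := MeasureTheory.addHaar_image_eq_zero_of_det_fderivWithin_eq_zero (volume : Measure (ℝ × ℝ)) hf hdet
  filter_upwards [compl_mem_ae_iff.2 h0] with x hx t ht r hr he
  exact hx ⟨(t, r), ⟨ht, hr⟩, he.symm⟩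

section Plane

variable {P : Type*} [NormedAddCommGroup P] [NormedSpace ℝ P]

/-- The area form of a plane with coordinates `e`, as a function of its first argument. -/
noncomputable def areaForm (e : P ≃L[ℝ] ℝ × ℝ) (w : P) : P →L[ℝ] ℝ :=
  (e w).2 • ((ContinuousLinearMap.fst ℝ ℝ ℝ).comp (e : P →L[ℝ] ℝ × ℝ)) -
    (e w).1 • ((ContinuousLinearMap.snd ℝ ℝ ℝ).comp (e : P →L[ℝ] ℝ × ℝ))

variable (e : P ≃L[ℝ] ℝ × ℝ)

theorem areaForm_apply (w u : P) :
    areaForm e w u = (e u).1 * (e w).2 - (e u).2 * (e w).1 := by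
  simp [areaForm]; ring

theorem areaForm_swap (w u : P) : areaForm e w u = -areaForm e u w := by
  rw [areaForm_apply, areaForm_apply]; ring

theorem areaForm_self (w : P) : areaForm e w w = 0 := by
  rw [areaForm_apply]; ring

theorem exists_eq_smul_of_areaForm_eq_zero {u w : P} (hu : u ≠ 0) (h : areaForm e w u = 0) :
    ∃ r : ℝ, w = r • u := by
  rw [areaForm_apply] at h
  have hu' : e u ≠ 0 := by simpa using hu
  by_cases h1 : (e u).1 = 0
  · have h2 : (e u).2 ≠ 0 := fun h2 => hu' (Prod.ext h1 h2)
    refine ⟨(e w).2 / (e u).2, e.injective (Prod.ext ?_ ?_)⟩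
    · simp only [map_smul, Prod.smul_fst, smul_eq_mul, h1, mul_zero]
      rw [h1] at h
      have : (e u).2 * (e w).1 = 0 := by linarith
      exact (mul_eq_zero.1 this).resolve_left h2
    · simp only [map_smul, Prod.smul_snd, smul_eq_mul]
      field_simp
  · refine ⟨(e w).1 / (e u).1, e.injective (Prod.ext ?_ ?_)⟩
    · simp only [map_smul, Prod.smul_fst, smul_eq_mul]
      field_simp
    · simp only [map_smul, Prod.smul_snd, smul_eq_mul]
      field_simp
      linarith

theorem linearIndependent_of_areaForm_ne_zero {u w : P} (h : areaForm e w u ≠ 0) :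
    LinearIndependent ℝ ![u, w] := by
  rw [LinearIndependent.pair_iff]
  intro a b hab
  have h1 : areaForm e w (a • u + b • w) = 0 := by rw [hab, map_zero]
  have h2 : areaForm e u (a • u + b • w) = 0 := by rw [hab, map_zero]
  rw [map_add, map_smul, map_smul, areaForm_self, smul_zero, add_zero, smul_eq_mul] at h1
  rw [map_add, map_smul, map_smul, areaForm_self, smul_zero, zero_add, areaForm_swap,
    smul_eq_mul] at h2
  refine ⟨(mul_eq_zero.1 h1).resolve_right h, (mul_eq_zero.1 h2).resolve_right ?_⟩
  simpa using h

/-- Almost every line through `p` avoids a given direction `u`. -/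
theorem ae_areaForm_ne_zero (p : P) {u : P} (hu : u ≠ 0) :
    ∀ᵐ x : ℝ × ℝ, areaForm e (e.symm x - p) u ≠ 0 := by
  -- With constant `a` and `b` every point is critical, and the image is the line through `p` in
  -- direction `u`.
  filter_upwards [ae_ne_of_ruled_critical univ (fun _ => e p) (fun _ => e u) 0 0
    (fun t _ => hasDerivAt_const t _) (fun t _ => hasDerivAt_const t _)] with x hx h
  obtain ⟨r, hr⟩ := exists_eq_smul_of_areaForm_eq_zero e hu h
  refine hx 0 trivial r (by simp) ?_
  rw [sub_eq_iff_eq_add'] at hr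
  rw [← map_smul, ← map_add, ← hr, ContinuousLinearEquiv.apply_symm_apply]

theorem ae_ne (p : P) : ∀ᵐ x : ℝ × ℝ, e.symm x ≠ p := by
  filter_upwards [MeasureTheory.Measure.ae_ne MeasureTheory.volume (e p)] with x hx h
  exact hx (by rw [← h, ContinuousLinearEquiv.apply_symm_apply])

end Plane

/-! ## Piecewise regular arcs -/

section Regular

variable {X : Type*} [NormedAddCommGroup X] [NormedSpace ℝ X] {γ : ℝ → X}

/-- There are finitely many break points, so a short interval starting at `t` has none in its
interior, and the curve is regular there up to its left end. This supplies one-sided tangents even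
at corners and end points. -/
theorem IsPiecewiseRegular.exists_hasDerivWithinAt_right (h : IsPiecewiseRegular γ) {t : ℝ}
    (ht : t ∈ Ico (0 : ℝ) 1) : ∃ v ≠ 0, HasDerivWithinAt γ v (Icc t 1) t := by
  obtain ⟨T, hT⟩ := h
  have h1 : ∀ᶠ b in 𝓝[>] t, ∀ s ∈ T, s ∉ Ioo t b := by
    rw [Filter.eventually_all_finset]
    intro s _
    rcases le_or_gt s t with hs | hs
    · exact Filter.Eventually.of_forall fun b hb => absurd hb.1 (not_lt.2 hs)
    · filter_upwards [Ioo_mem_nhdsGT hs] with b hb hsb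
      exact lt_asymm hb.2 hsb.2
  obtain ⟨b, hb1, hb2⟩ := (h1.and (Ioo_mem_nhdsGT ht.2)).exists
  obtain ⟨hc, hd⟩ := hT t b ht.1 hb2.1 hb2.2.le hb1
  have hmem : t ∈ Icc t b := left_mem_Icc.2 hb2.1.le
  refine ⟨_, hd t hmem, ((hc.differentiableOn one_ne_zero t hmem).hasDerivWithinAt).mono_of_mem_nhdsWithin ?_⟩
  filter_upwards [self_mem_nhdsWithin, mem_nhdsWithin_of_mem_nhds (Iio_mem_nhds hb2.1)]
    with s hs hs' using ⟨hs.1, le_of_lt hs'⟩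

theorem IsPiecewiseRegular.exists_hasDerivWithinAt_left (h : IsPiecewiseRegular γ) {t : ℝ}
    (ht : t ∈ Ioc (0 : ℝ) 1) : ∃ v ≠ 0, HasDerivWithinAt γ v (Icc 0 t) t := by
  obtain ⟨T, hT⟩ := h
  have h1 : ∀ᶠ a in 𝓝[<] t, ∀ s ∈ T, s ∉ Ioo a t := by
    rw [Filter.eventually_all_finset]
    intro s _
    rcases le_or_gt t s with hs | hs
    · exact Filter.Eventually.of_forall fun b hb => absurd hb.2 (not_lt.2 hs)
    · filter_upwards [Ioo_mem_nhdsLT hs] with b hb hsb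
      exact lt_asymm hb.1 hsb.1
  obtain ⟨a, ha1, ha2⟩ := (h1.and (Ioo_mem_nhdsLT ht.1)).exists
  obtain ⟨hc, hd⟩ := hT a t ha2.1.le ha2.2 ht.2 ha1
  have hmem : t ∈ Icc a t := right_mem_Icc.2 ha2.2.le
  refine ⟨_, hd t hmem, ((hc.differentiableOn one_ne_zero t hmem).hasDerivWithinAt).mono_of_mem_nhdsWithin ?_⟩
  filter_upwards [self_mem_nhdsWithin, mem_nhdsWithin_of_mem_nhds (Ioi_mem_nhds ha2.2)]
    with s hs hs' using ⟨le_of_lt hs', hs.2⟩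

theorem IsPiecewiseRegular.continuousOn (h : IsPiecewiseRegular γ) :
    ContinuousOn γ (Icc 0 1) := by
  intro t ht
  rw [← Icc_union_Icc_eq_Icc ht.1 ht.2, continuousWithinAt_union]
  constructor
  · rcases ht.1.eq_or_lt with rfl | h0
    · rw [Icc_self]; exact continuousWithinAt_singleton
    · obtain ⟨v, -, hv⟩ := h.exists_hasDerivWithinAt_left ⟨h0, ht.2⟩
      exact hv.continuousWithinAt
  · rcases ht.2.eq_or_lt with rfl | h1
    · rw [Icc_self]; exact continuousWithinAt_singleton
    · obtain ⟨v, -, hv⟩ := h.exists_hasDerivWithinAt_right ⟨ht.1, h1⟩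
      exact hv.continuousWithinAt

theorem IsPiecewiseRegular.exists_contDiffAt (h : IsPiecewiseRegular γ) :
    ∃ T : Finset ℝ, ∀ t ∈ Ioo (0 : ℝ) 1, t ∉ T → ContDiffAt ℝ 1 γ t := by
  obtain ⟨T, hT⟩ := h
  refine ⟨T, fun t ht htT => ?_⟩
  have hU : Ioo (0 : ℝ) 1 ∩ (T : Set ℝ)ᶜ ∈ 𝓝 t :=
    Filter.inter_mem (Ioo_mem_nhds ht.1 ht.2) (T.finite_toSet.isClosed.isOpen_compl.mem_nhds htT)
  obtain ⟨a, b, hab, hsub⟩ := mem_nhds_iff_exists_Ioo_subset.1 hU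
  obtain ⟨a', ha'⟩ := exists_between hab.1
  obtain ⟨b', hb'⟩ := exists_between hab.2
  have ha0 := (hsub ⟨ha'.1, ha'.2.trans hab.2⟩).1
  have hb0 := (hsub ⟨hab.1.trans hb'.1, hb'.2⟩).1
  refine (hT a' b' ha0.1.le (ha'.2.trans hb'.1) hb0.2.le fun s hs hs' => ?_).1.contDiffAt
    (Icc_mem_nhds ha'.2 hb'.1)
  exact (hsub ⟨ha'.1.trans hs'.1, hs'.2.trans hb'.2⟩).2 hs

end Regular

/-! ## Lines and arcs in general position -/

section Lines

variable {P : Type*} [NormedAddCommGroup P] [NormedSpace ℝ P] (e : P ≃L[ℝ] ℝ × ℝ) {γ : ℝ → P}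

/-- The line through `p` and `m` meets the arc `γ` transversely, and away from the end points and
corners of `γ`, except that `p` itself may be an end point of `γ`. -/
def MeetsLineTransversely (γ : ℝ → P) (p m : P) : Prop :=
  ∀ t ∈ Icc (0 : ℝ) 1, areaForm e (m - p) (γ t - p) = 0 →
    (γ t = p ∨ t ∈ Ioo (0 : ℝ) 1 ∧ ContDiffAt ℝ 1 γ t) ∧
      ∃ v, HasDerivWithinAt γ v (Icc 0 1) t ∧ areaForm e (m - p) v ≠ 0

/-- The bad positions of `m` lie on finitely many lines through `p` (towards corners and end points
of `γ`, or along an end tangent of `γ`) or on a line through `p` tangent to `γ` at a smooth point.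
The union of the latter is null by Sard's theorem. -/
theorem IsPiecewiseRegular.ae_meetsLineTransversely (h : IsPiecewiseRegular γ) {p : P}
    (hp : ∀ t ∈ Ioo (0 : ℝ) 1, p ≠ γ t) :
    ∀ᵐ x : ℝ × ℝ, MeetsLineTransversely e γ p (e.symm x) := by
  obtain ⟨T, hT⟩ := h.exists_contDiffAt
  obtain ⟨v₀, hv₀, hd₀⟩ := h.exists_hasDerivWithinAt_right (t := 0) (by simp)
  obtain ⟨v₁, hv₁, hd₁⟩ := h.exists_hasDerivWithinAt_left (t := 1) (by simp)
  have hfin : ∀ᵐ x : ℝ × ℝ, ∀ t ∈ insert 0 (insert 1 T),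
      γ t ≠ p → areaForm e (e.symm x - p) (γ t - p) ≠ 0 := by
    rw [Filter.eventually_all_finset]
    intro t _
    by_cases htp : γ t = p
    · exact Filter.Eventually.of_forall fun x hx => absurd htp hx
    · filter_upwards [ae_areaForm_ne_zero e p (sub_ne_zero.2 htp)] with x hx _ using hx
  -- The rulings are the lines joining `p` to `γ t`. The Jacobian is `r` times the area form of `γ t
  -- - p` and the velocity, so points on tangent lines through `p` are critical values.
  have hsard := ae_ne_of_ruled_critical (Ioo 0 1 \ T) (fun _ => e p) (fun t => e (γ t - p)) 0
    (fun t => e (deriv γ t)) (fun t _ => hasDerivAt_const t _) (fun t ht => by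
      have h1 : HasDerivAt (fun t => γ t - p) (deriv γ t) t :=
        (((hT t ht.1 ht.2).differentiableAt one_ne_zero).hasDerivAt).sub_const p
      exact (e : P →L[ℝ] ℝ × ℝ).hasFDerivAt.comp_hasDerivAt t h1)
  filter_upwards [hfin, hsard, ae_areaForm_ne_zero e p hv₀, ae_areaForm_ne_zero e p hv₁,
    ae_ne e p] with x hx hs h0 h1 hne t ht hz
  by_cases htp : γ t = p
  · refine ⟨Or.inl htp, ?_⟩
    rcases ht.1.eq_or_lt with rfl | ht0
    · exact ⟨v₀, hd₀, h0⟩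
    rcases ht.2.eq_or_lt with rfl | ht1
    · exact ⟨v₁, hd₁, h1⟩
    exact absurd htp.symm (hp t ⟨ht0, ht1⟩)
  · have htB : t ∉ insert 0 (insert 1 T) := fun hB => hx t hB htp hz
    simp only [Finset.mem_insert, not_or] at htB
    have htI : t ∈ Ioo (0 : ℝ) 1 :=
      ⟨lt_of_le_of_ne ht.1 (Ne.symm htB.1), lt_of_le_of_ne ht.2 htB.2.1⟩
    have hcd := hT t htI htB.2.2
    refine ⟨Or.inr ⟨htI, hcd⟩, deriv γ t,
      (hcd.differentiableAt one_ne_zero).hasDerivAt.hasDerivWithinAt, ?_⟩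
    obtain ⟨r, hr⟩ := exists_eq_smul_of_areaForm_eq_zero e (sub_ne_zero.2 htp) hz
    intro hzero
    have hr0 : r ≠ 0 := fun h => hne (by rwa [h, zero_smul, sub_eq_zero] at hr)
    refine hs t ⟨htI, htB.2.2⟩ r ?_ ?_
    · rw [hr, areaForm_apply, map_smul] at hzero
      simp only [Prod.smul_fst, Prod.smul_snd, smul_eq_mul] at hzero
      simp only [Pi.zero_apply, zero_add, Prod.smul_fst, Prod.smul_snd, smul_eq_mul]
      linarith
    · rw [← map_smul, ← map_add, ← hr, add_sub_cancel, ContinuousLinearEquiv.apply_symm_apply]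

/-- Sard's theorem with `b = 0`: the ruled map has rank at most one everywhere, so its whole image,
the smooth part of the arc, is null. Corners and ends add finitely many points. -/
theorem IsPiecewiseRegular.ae_notMem_image (h : IsPiecewiseRegular γ) :
    ∀ᵐ x : ℝ × ℝ, e.symm x ∉ γ '' Icc 0 1 := by
  obtain ⟨T, hT⟩ := h.exists_contDiffAt
  have hfin : ∀ᵐ x : ℝ × ℝ, ∀ t ∈ insert 0 (insert 1 T), e.symm x ≠ γ t := by
    rw [Filter.eventually_all_finset]
    exact fun t _ => ae_ne e (γ t)
  have hsard := ae_ne_of_ruled_critical (Ioo 0 1 \ T) (fun t => e (γ t)) 0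
    (fun t => e (deriv γ t)) 0 (fun t ht =>
      (e : P →L[ℝ] ℝ × ℝ).hasFDerivAt.comp_hasDerivAt t
        ((hT t ht.1 ht.2).differentiableAt one_ne_zero).hasDerivAt)
    (fun t _ => hasDerivAt_const t _)
  filter_upwards [hfin, hsard] with x hx hs
  rintro ⟨t, ht, htx⟩
  have htB : t ∉ insert 0 (insert 1 T) := fun hB => hx t hB htx.symm
  simp only [Finset.mem_insert, not_or] at htB
  have htI : t ∈ Ioo (0 : ℝ) 1 :=
    ⟨lt_of_le_of_ne ht.1 (Ne.symm htB.1), lt_of_le_of_ne ht.2 htB.2.1⟩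
  refine hs t ⟨htI, htB.2.2⟩ 0 (by simp) ?_
  simp [htx]

/-- A function on `[0, 1]` all of whose zeros are simple has finitely many zeros. -/
theorem finite_zeros_of_simple {g : ℝ → ℝ} (hg : ContinuousOn g (Icc 0 1))
    (h : ∀ t ∈ Icc (0 : ℝ) 1, g t = 0 → ∃ v ≠ 0, HasDerivWithinAt g v (Icc 0 1) t) :
    {t ∈ Icc (0 : ℝ) 1 | g t = 0}.Finite := by
  by_contra hinf
  obtain ⟨t, ht, hacc⟩ := Set.Infinite.exists_accPt_of_subset_isCompact hinf isCompact_Icc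
    (fun _ hs => hs.1)
  rw [accPt_iff_frequently_nhdsNE] at hacc
  have hev : ∀ᶠ s in 𝓝[≠] t, s ∈ Icc (0 : ℝ) 1 → g s ≠ 0 := by
    -- Zeros cannot accumulate at `t`: a simple zero is isolated, and a nonzero value persists
    -- nearby by continuity.
    by_cases h0 : g t = 0
    · obtain ⟨v, hv, hd⟩ := h t ht h0
      have := hd.eventually_ne (c := 0) hv
      rw [sdiff_eq, inter_comm, nhdsWithin_inter', Filter.eventually_inf_principal] at this
      exact this
    · have := (hg t ht).eventually_ne h0
      rw [eventually_nhdsWithin_iff] at this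
      exact this.filter_mono nhdsWithin_le_nhds
  obtain ⟨s, hs, hs'⟩ := (hacc.and_eventually hev).exists
  exact hs' hs.1 hs.2

/-- Transversality says that the area form, restricted to the arc, has only simple zeros. This
includes an end of `γ` lying at `p`, which is why the one-sided derivative is controlled there too.
-/
theorem MeetsLineTransversely.finite {p m : P} (h : MeetsLineTransversely e γ p m)
    (hγ : IsPiecewiseRegular γ) :
    {t ∈ Icc (0 : ℝ) 1 | areaForm e (m - p) (γ t - p) = 0}.Finite := by
  refine finite_zeros_of_simple
    ((areaForm e (m - p)).continuous.comp_continuousOn (hγ.continuousOn.sub continuousOn_const))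
    fun t ht h0 => ?_
  obtain ⟨-, v, hv, hv0⟩ := h t ht h0
  exact ⟨_, hv0, (areaForm e (m - p)).hasFDerivAt.comp_hasDerivWithinAt t (hv.sub_const p)⟩

end Lines

/-! ## Broken arcs -/

section BrokenArc

variable {P : Type*} [NormedAddCommGroup P] [NormedSpace ℝ P]

/-- The arc from `p` to `q` with a corner at `m`, consisting of two segments. -/
noncomputable def brokenArc (p m q : P) (t : ℝ) : P :=
  if t ≤ 1 / 2 then p + (2 * t) • (m - p) else q + (2 - 2 * t) • (m - q)

theorem brokenArc_of_le {p m q : P} {t : ℝ} (ht : t ≤ 1 / 2) :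
    brokenArc p m q t = p + (2 * t) • (m - p) := if_pos ht

theorem brokenArc_of_ge {p m q : P} {t : ℝ} (ht : 1 / 2 ≤ t) :
    brokenArc p m q t = q + (2 - 2 * t) • (m - q) := by
  rcases ht.eq_or_lt with rfl | h
  · rw [brokenArc_of_le le_rfl]
    norm_num
  · exact if_neg (not_le.2 h)

theorem brokenArc_zero (p m q : P) : brokenArc p m q 0 = p := by
  rw [brokenArc_of_le (by norm_num)]; simp

theorem brokenArc_one (p m q : P) : brokenArc p m q 1 = q := by
  rw [brokenArc_of_ge (by norm_num)]; simp

theorem brokenArc_half (p m q : P) : brokenArc p m q (1 / 2) = m := by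
  rw [brokenArc_of_le le_rfl]; simp

theorem brokenArc_swap (p m q : P) (t : ℝ) : brokenArc q m p t = brokenArc p m q (1 - t) := by
  rcases le_total t (1 / 2) with h | h
  · rw [brokenArc_of_le h, brokenArc_of_ge (by linarith)]
    congr 2; ring
  · rw [brokenArc_of_ge h, brokenArc_of_le (by linarith)]
    congr 2; ring

theorem isPiecewiseRegular_brokenArc {p m q : P} (hp : m ≠ p) (hq : m ≠ q) :
    IsPiecewiseRegular (brokenArc p m q) := by
  have key : ∀ (x u : P) (a b c : ℝ) (s : Set ℝ), b ≠ 0 → u ≠ 0 → UniqueDiffOn ℝ s →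
      (∀ t ∈ s, brokenArc p m q t = x + (c + b * t) • u) →
      ContDiffOn ℝ 1 (brokenArc p m q) s ∧ ∀ t ∈ s, derivWithin (brokenArc p m q) s t ≠ 0 := by
    intro x u _ b c s hb hu hs heq
    have hd : ∀ t, HasDerivAt (fun t : ℝ => x + (c + b * t) • u) (b • u) t := fun t => by
      have := ((((hasDerivAt_id t).const_mul b).const_add c).smul_const u).const_add x
      simpa using this
    refine ⟨ContDiffOn.congr (f := fun t : ℝ => x + (c + b * t) • u)
      (ContDiff.contDiffOn (by fun_prop)) heq, fun t ht => ?_⟩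
    rw [derivWithin_congr heq (heq t ht), ((hd t).hasDerivWithinAt).derivWithin (hs t ht)]
    exact smul_ne_zero hb hu
  refine ⟨{1 / 2}, fun a b ha hab hb hT => ?_⟩
  have h : b ≤ 1 / 2 ∨ 1 / 2 ≤ a := by
    by_contra! h
    exact hT _ (Finset.mem_singleton_self _) ⟨h.2, h.1⟩
  rcases h with h | h
  · refine key p (m - p) 0 2 0 _ two_ne_zero (sub_ne_zero.2 hp) (uniqueDiffOn_Icc hab) fun t ht => ?_
    rw [brokenArc_of_le (ht.2.trans h), zero_add]
  · refine key q (m - q) 0 (-2) 2 _ (by norm_num) (sub_ne_zero.2 hq) (uniqueDiffOn_Icc hab)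
      fun t ht => ?_
    rw [brokenArc_of_ge (h.trans ht.1)]
    congr 2; ring

variable (e : P ≃L[ℝ] ℝ × ℝ)

/-- The triangle `p`, `m`, `q` is nondegenerate, so the line through `p` and `m` meets the second
segment only at `m`. -/
theorem brokenArc_injective {p m q : P} (h : areaForm e (m - p) (q - p) ≠ 0) :
    Function.Injective (brokenArc p m q) := by
  have hA : m - p ≠ 0 := by
    intro h0
    rw [h0, areaForm_apply, map_zero] at h
    simp at h
  have hB : m - q ≠ 0 := by
    intro h0
    rw [← sub_eq_zero.1 h0, areaForm_self] at h
    exact h rfl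
  have key : ∀ s t : ℝ, s ≤ 1 / 2 → 1 / 2 ≤ t → brokenArc p m q s = brokenArc p m q t → s = t := by
    intro s t hs ht he
    rw [brokenArc_of_le hs, brokenArc_of_ge ht] at he
    -- Measured from `m`, the form vanishes on the first segment and equals `2 * t - 1` times a
    -- nonzero number on the second.
    have h1 : areaForm e (m - p) (p - m + (2 * s) • (m - p)) =
        areaForm e (m - p) (q - m + (2 - 2 * t) • (m - q)) := by
      have h2 := congrArg (fun z => areaForm e (m - p) (z - m)) he
      rw [show p - m + (2 * s) • (m - p) = p + (2 * s) • (m - p) - m by abel,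
        show q - m + (2 - 2 * t) • (m - q) = q + (2 - 2 * t) • (m - q) - m by abel, h2]
    rw [show p - m + (2 * s) • (m - p) = (2 * s - 1) • (m - p) by module,
      show q - m + (2 - 2 * t) • (m - q) = (2 * t - 1) • (q - p) - (2 * t - 1) • (m - p) by module,
      map_sub, map_smul, map_smul, map_smul, areaForm_self, smul_zero, smul_zero, sub_zero] at h1
    have ht' : 2 * t - 1 = 0 := (mul_eq_zero.1 h1.symm).resolve_right h
    have hte : t = 1 / 2 := by linarith
    subst hte
    have h3 : (2 * s - 1) • (m - p) = 0 := by
      rw [show (2 * s - 1) • (m - p) = p + (2 * s) • (m - p) - m by module, he]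
      norm_num
    have := (smul_eq_zero.1 h3).resolve_right hA
    linarith
  intro s t he
  rcases le_total s (1 / 2) with hs | hs <;> rcases le_total t (1 / 2) with ht | ht
  · rw [brokenArc_of_le hs, brokenArc_of_le ht] at he
    have := smul_left_injective ℝ hA (add_left_cancel he)
    linarith
  · exact key s t hs ht he
  · exact (key t s ht hs he.symm).symm
  · rw [brokenArc_of_ge hs, brokenArc_of_ge ht] at he
    have := smul_left_injective ℝ hB (add_left_cancel he)
    linarith

theorem IsTransverse.symm {γ δ : ℝ → P} {s t : ℝ} (h : IsTransverse γ s δ t) :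
    IsTransverse δ t γ s :=
  ⟨h.2.1, h.1, LinearIndependent.pair_symm_iff.1 h.2.2⟩

theorem isTransverse_of_eventuallyEq_line {γ δ : ℝ → P} {x u : P} {s t b c : ℝ} (hb : b ≠ 0)
    (hδ : δ =ᶠ[𝓝 s] fun r => x + (c + b * r) • u) (hγ : ContDiffAt ℝ 1 γ t)
    (h : areaForm e u (deriv γ t) ≠ 0) : IsTransverse γ t δ s := by
  have hd : HasDerivAt (fun r : ℝ => x + (c + b * r) • u) (b • u) s := by
    have := ((((hasDerivAt_id s).const_mul b).const_add c).smul_const u).const_add x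
    simpa using this
  refine ⟨hγ, ContDiffAt.congr_of_eventuallyEq (ContDiff.contDiffAt (by fun_prop)) hδ, ?_⟩
  rw [hδ.deriv_eq, hd.deriv]
  refine linearIndependent_of_areaForm_ne_zero e ?_
  rw [areaForm_swap, map_smul, areaForm_swap, smul_eq_mul]
  simpa using ⟨hb, h⟩

/-- A broken arc in general position to an arc `γ` meets it transversely. -/
theorem MeetsLineTransversely.isTransverse_brokenArc {γ : ℝ → P} {p m q : P}
    (hp : MeetsLineTransversely e γ p m) (hq : MeetsLineTransversely e γ q m)
    (hm : m ∉ γ '' Icc 0 1) (hmp : m ≠ p) (hmq : m ≠ q) {s t : ℝ} (hs : s ∈ Ioo (0 : ℝ) 1)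
    (ht : t ∈ Icc (0 : ℝ) 1) (he : brokenArc p m q s = γ t) :
    t ∈ Ioo (0 : ℝ) 1 ∧ IsTransverse γ t (brokenArc p m q) s := by
  rcases lt_trichotomy s (1 / 2) with h | rfl | h
  · rw [brokenArc_of_le h.le] at he
    obtain ⟨h1, v, hv, hv0⟩ := hp t ht (by
      rw [← he, add_sub_cancel_left, map_smul, areaForm_self, smul_zero])
    -- Since `0 < s`, the meeting point is not `p`; this rules out the exceptional end point case of
    -- `MeetsLineTransversely`.
    have hne : γ t ≠ p := by
      rw [← he, ne_eq, add_eq_left]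
      exact smul_ne_zero (by linarith [hs.1]) (sub_ne_zero.2 hmp)
    obtain ⟨htI, hcd⟩ := h1.resolve_left hne
    refine ⟨htI, isTransverse_of_eventuallyEq_line e (x := p) (u := m - p) (b := 2) (c := 0)
      two_ne_zero ?_ hcd ?_⟩
    · filter_upwards [Iio_mem_nhds h] with r hr
      rw [brokenArc_of_le (le_of_lt hr), zero_add]
    · rwa [(hv.hasDerivAt (Icc_mem_nhds htI.1 htI.2)).deriv]
  · rw [brokenArc_half] at he
    exact absurd ⟨t, ht, he.symm⟩ hm
  · rw [brokenArc_of_ge h.le] at he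
    obtain ⟨h1, v, hv, hv0⟩ := hq t ht (by
      rw [← he, add_sub_cancel_left, map_smul, areaForm_self, smul_zero])
    have hne : γ t ≠ q := by
      rw [← he, ne_eq, add_eq_left]
      exact smul_ne_zero (by linarith [hs.2]) (sub_ne_zero.2 hmq)
    obtain ⟨htI, hcd⟩ := h1.resolve_left hne
    refine ⟨htI, isTransverse_of_eventuallyEq_line e (x := q) (u := m - q) (b := -2) (c := 2)
      (by norm_num) ?_ hcd ?_⟩
    · filter_upwards [Ioi_mem_nhds h] with r hr
      rw [brokenArc_of_ge (le_of_lt hr)]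
      congr 2; ring
    · rwa [(hv.hasDerivAt (Icc_mem_nhds htI.1 htI.2)).deriv]

/-- Lets statements about the two lines (finitely many intersections, no old crossing on them) be
used for the broken arc. -/
theorem brokenArc_on_line (p m q : P) (s : ℝ) :
    areaForm e (m - p) (brokenArc p m q s - p) = 0 ∨
      areaForm e (m - q) (brokenArc p m q s - q) = 0 := by
  rcases le_total s (1 / 2) with h | h
  · left
    rw [brokenArc_of_le h, add_sub_cancel_left, map_smul, areaForm_self, smul_zero]
  · right
    rw [brokenArc_of_ge h, add_sub_cancel_left, map_smul, areaForm_self, smul_zero]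

end BrokenArc

/-! ## Replacing an arc by a broken arc -/

section Replace

variable {D P : Type*} [NormedAddCommGroup P] [NormedSpace ℝ P]

open Classical in
/-- The system of arcs in which the arc `d₀` is replaced by a broken arc with corner `m`. -/
noncomputable def replaceArc (rev : Equiv.Perm D) (γ : D → ℝ → P) (d₀ : D) (m : P) : D → ℝ → P :=
  fun d => if d = d₀ ∨ d = rev d₀ then brokenArc (γ d 0) m (γ (rev d) 0) else γ d

/-- The point `m` is in general position with respect to the arcs `γ` and the end points of `d₀`. -/
structure IsGoodCorner (e : P ≃L[ℝ] ℝ × ℝ) (rev : Equiv.Perm D) (γ : D → ℝ → P) (p q m : P) :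
    Prop where
  area : areaForm e (m - p) (q - p) ≠ 0
  ne_left : m ≠ p
  ne_right : m ≠ q
  meets_left : ∀ d, MeetsLineTransversely e (γ d) p m
  meets_right : ∀ d, MeetsLineTransversely e (γ d) q m
  notMem : ∀ d, m ∉ γ d '' Icc 0 1
  crossing_left : ∀ d d' x, IsCrossing rev γ d d' x → areaForm e (m - p) (x - p) ≠ 0
  crossing_right : ∀ d d' x, IsCrossing rev γ d d' x → areaForm e (m - q) (x - q) ≠ 0

variable {e : P ≃L[ℝ] ℝ × ℝ} {rev glue : Equiv.Perm D} {γ : D → ℝ → P} {d₀ : D} {m : P}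

theorem IsGoodCorner.swap {p q : P} (h : IsGoodCorner e rev γ p q m) :
    IsGoodCorner e rev γ q p m where
  area := by
    have := h.area
    rw [areaForm_apply] at this ⊢
    simp only [map_sub, Prod.fst_sub, Prod.snd_sub] at this ⊢
    intro h0
    apply this
    linarith
  ne_left := h.ne_right
  ne_right := h.ne_left
  meets_left := h.meets_right
  meets_right := h.meets_left
  notMem := h.notMem
  crossing_left := h.crossing_right
  crossing_right := h.crossing_left

/-- A finite conjunction of almost sure conditions: there are finitely many arcs and finitely many
crossings, and a crossing is never an end point, so each crossing excludes only one line through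
each of the two points. -/
theorem IsGenericSystem.ae_isGoodCorner [Finite D] (h : IsGenericSystem rev glue γ) {d d' : D}
    (hne : γ d 0 ≠ γ d' 0) :
    ∀ᵐ x : ℝ × ℝ, IsGoodCorner e rev γ (γ d 0) (γ d' 0) (e.symm x) := by
  have hcross : ∀ k, ∀ᵐ x : ℝ × ℝ, ∀ y ∈ {p | ∃ d d', IsCrossing rev γ d d' p},
      areaForm e (e.symm x - γ k 0) (y - γ k 0) ≠ 0 := by
    intro k
    refine (MeasureTheory.ae_ball_iff h.finite.countable).2 ?_
    rintro y ⟨i, j, s, hs, -, -, hy, -⟩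
    refine ae_areaForm_ne_zero e _ (sub_ne_zero.2 ?_)
    rw [← hy]
    exact (h.ends k i s hs).symm
  filter_upwards [ae_areaForm_ne_zero e (γ d 0) (sub_ne_zero.2 hne.symm), ae_ne e (γ d 0),
    ae_ne e (γ d' 0),
    Filter.eventually_all.2 fun k => (h.regular k).ae_meetsLineTransversely e (h.ends d k),
    Filter.eventually_all.2 fun k => (h.regular k).ae_meetsLineTransversely e (h.ends d' k),
    Filter.eventually_all.2 fun k => (h.regular k).ae_notMem_image e, hcross d, hcross d']
    with x h1 h2 h3 h4 h5 h6 h7 h8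
  exact ⟨h1, h2, h3, h4, h5, h6, fun _ _ y hy => h7 y ⟨_, _, hy⟩, fun _ _ y hy => h8 y ⟨_, _, hy⟩⟩

theorem replaceArc_of_mem {d : D} (hd : d = d₀ ∨ d = rev d₀) :
    replaceArc rev γ d₀ m d = brokenArc (γ d 0) m (γ (rev d) 0) := if_pos hd

theorem replaceArc_of_notMem {d : D} (hd : ¬ (d = d₀ ∨ d = rev d₀)) :
    replaceArc rev γ d₀ m d = γ d := if_neg hd

theorem replaceArc_zero (d : D) : replaceArc rev γ d₀ m d 0 = γ d 0 := by
  by_cases hd : d = d₀ ∨ d = rev d₀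
  · rw [replaceArc_of_mem hd, brokenArc_zero]
  · rw [replaceArc_of_notMem hd]

theorem rev_mem_iff (hr : IsPairing rev) (d : D) :
    (rev d = d₀ ∨ rev d = rev d₀) ↔ (d = d₀ ∨ d = rev d₀) := by
  rw [rev.apply_eq_iff_eq, or_comm, ← rev.apply_eq_iff_eq (x := d) (y := rev d₀), hr.1]

/-- Three facts cover all coincidences involving the new arc: it does not meet itself (`same`), it
meets the other arcs transversely at interior smooth points (`trans`), and it avoids their mutual
crossings (`avoid`). Coincidences among the other arcs are those of the old system. -/
theorem IsGenericSystem.replaceArc [Finite D] (hr : IsPairing rev) (h : IsGenericSystem rev glue γ)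
    (hm : IsGoodCorner e rev γ (γ d₀ 0) (γ (rev d₀) 0) m) :
    IsGenericSystem rev glue (replaceArc rev γ d₀ m) := by
  -- The new arc occurs with both orientations; reversal exchanges `p` and `q`.
  have good : ∀ {d}, d = d₀ ∨ d = rev d₀ → IsGoodCorner e rev γ (γ d 0) (γ (rev d) 0) m := by
    rintro d (rfl | rfl)
    · exact hm
    · rw [hr.1]; exact hm.swap
  have same : ∀ {d d' : D} {s t : ℝ}, d = d₀ ∨ d = rev d₀ → d' = d₀ ∨ d' = rev d₀ →
      _root_.replaceArc rev γ d₀ m d s = _root_.replaceArc rev γ d₀ m d' t →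
      SameParam rev d s d' t := by
    intro d d' s t hd hd' he
    rw [replaceArc_of_mem hd, replaceArc_of_mem hd'] at he
    have hdd : d' = d ∨ d' = rev d := by
      rcases hd with rfl | rfl <;> rcases hd' with rfl | rfl <;> simp [hr.1]
    have hinj := brokenArc_injective e (good hd).area
    rcases hdd with rfl | rfl
    · exact Or.inl ⟨rfl, (hinj he).symm⟩
    · rw [hr.1, brokenArc_swap (γ d 0)] at he
      exact Or.inr ⟨rfl, by linarith [hinj he]⟩
  have trans : ∀ {d d' : D} {s t : ℝ}, d = d₀ ∨ d = rev d₀ → ¬ (d' = d₀ ∨ d' = rev d₀) →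
      s ∈ Ioo (0 : ℝ) 1 → t ∈ Icc (0 : ℝ) 1 →
      _root_.replaceArc rev γ d₀ m d s = _root_.replaceArc rev γ d₀ m d' t →
      t ∈ Ioo (0 : ℝ) 1 ∧ IsTransverse (_root_.replaceArc rev γ d₀ m d') t
        (_root_.replaceArc rev γ d₀ m d) s := by
    intro d d' s t hd hd' hs ht he
    rw [replaceArc_of_mem hd, replaceArc_of_notMem hd'] at he ⊢
    have hg := good hd
    exact (hg.meets_left d').isTransverse_brokenArc e (hg.meets_right d') (hg.notMem d')
      hg.ne_left hg.ne_right hs ht he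
  have avoid : ∀ {d d' d'' : D} {s t u : ℝ}, d = d₀ ∨ d = rev d₀ → ¬ (d' = d₀ ∨ d' = rev d₀) →
      ¬ (d'' = d₀ ∨ d'' = rev d₀) → t ∈ Ioo (0 : ℝ) 1 → u ∈ Ioo (0 : ℝ) 1 →
      _root_.replaceArc rev γ d₀ m d s = _root_.replaceArc rev γ d₀ m d' t →
      _root_.replaceArc rev γ d₀ m d s = _root_.replaceArc rev γ d₀ m d'' u →
      SameParam rev d' t d'' u := by
    intro d d' d'' s t u hd hd' hd'' ht hu h1 h2
    rw [replaceArc_of_mem hd, replaceArc_of_notMem hd'] at h1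
    rw [replaceArc_of_mem hd, replaceArc_of_notMem hd''] at h2
    by_contra hne
    have hc : IsCrossing rev γ d' d'' (γ d' t) := ⟨t, ht, u, hu, rfl, h2.symm.trans h1, hne⟩
    rcases brokenArc_on_line e (γ d 0) m (γ (rev d) 0) s with h0 | h0
    · exact (good hd).crossing_left _ _ _ hc (h1 ▸ h0)
    · exact (good hd).crossing_right _ _ _ hc (h1 ▸ h0)
  refine ⟨⟨?_, ?_, ?_, ?_⟩, ?_, ?_, ?_⟩
  · intro d
    by_cases hd : d = d₀ ∨ d = rev d₀
    · rw [replaceArc_of_mem hd]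
      exact isPiecewiseRegular_brokenArc (good hd).ne_left (good hd).ne_right
    · rw [replaceArc_of_notMem hd]
      exact h.regular d
  · intro d t ht
    by_cases hd : d = d₀ ∨ d = rev d₀
    · rw [replaceArc_of_mem hd, replaceArc_of_mem ((rev_mem_iff hr d).2 hd), hr.1, brokenArc_swap]
    · rw [replaceArc_of_notMem hd, replaceArc_of_notMem (mt (rev_mem_iff hr d).1 hd)]
      exact h.reverse d t ht
  · intro d d'
    rw [replaceArc_zero, replaceArc_zero]
    exact h.joint d d'
  · intro d d' t ht he
    by_cases hd' : d' = d₀ ∨ d' = rev d₀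
    · by_cases hd : d = d₀ ∨ d = rev d₀
      · rcases same hd hd' he with ⟨-, rfl⟩ | ⟨-, rfl⟩
        · exact lt_irrefl _ ht.1
        · norm_num at ht
      -- By `trans`, the new arc meets `d` only at interior parameters, and `0` is not one.
      · exact lt_irrefl _ (trans hd' hd ht (left_mem_Icc.2 zero_le_one) he.symm).1.1
    · rw [replaceArc_zero, replaceArc_of_notMem hd'] at he
      exact h.ends d d' t ht he
  · intro d d' s hs t ht he
    by_cases hd : d = d₀ ∨ d = rev d₀ <;> by_cases hd' : d' = d₀ ∨ d' = rev d₀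
    · exact Or.inl (same hd hd' he)
    · exact Or.inr (trans hd hd' hs (Ioo_subset_Icc_self ht) he).2.symm
    · exact Or.inr (trans hd' hd ht (Ioo_subset_Icc_self hs) he.symm).2
    · rw [replaceArc_of_notMem hd, replaceArc_of_notMem hd'] at he ⊢
      exact h.transverse d d' s hs t ht he
  · intro i j k s hs t ht u hu h1 h2
    have h3 := h1.symm.trans h2
    -- Two passages of the new arc coincide by `same`; with exactly one, `avoid` identifies the
    -- other two; with none, the old system decides.
    by_cases hi : i = d₀ ∨ i = rev d₀ <;> by_cases hj : j = d₀ ∨ j = rev d₀ <;>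
      by_cases hk : k = d₀ ∨ k = rev d₀
    · exact Or.inl (same hi hj h1)
    · exact Or.inl (same hi hj h1)
    · exact Or.inr (Or.inl (same hi hk h2))
    · exact Or.inr (Or.inr (avoid hi hj hk ht hu h1 h2))
    · exact Or.inr (Or.inr (same hj hk h3))
    · exact Or.inr (Or.inl (avoid hj hi hk hs hu h1.symm h3))
    · exact Or.inl (avoid hk hi hj hs ht h2.symm h3.symm)
    · rw [replaceArc_of_notMem hi, replaceArc_of_notMem hj] at h1
      rw [replaceArc_of_notMem hi, replaceArc_of_notMem hk] at h2
      exact h.no_triple i j k s hs t ht u hu h1 h2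
  -- Every new crossing lies where an old arc meets one of the two lines through `m`.
  · have hfin : (⋃ d, γ d '' {t ∈ Icc (0 : ℝ) 1 | areaForm e (m - γ d₀ 0) (γ d t - γ d₀ 0) = 0} ∪
        γ d '' {t ∈ Icc (0 : ℝ) 1 |
          areaForm e (m - γ (rev d₀) 0) (γ d t - γ (rev d₀) 0) = 0}).Finite :=
      Set.finite_iUnion fun d => (((hm.meets_left d).finite e (h.regular d)).image _).union
        (((hm.meets_right d).finite e (h.regular d)).image _)
    have mem : ∀ {d d' : D} {s t : ℝ}, d = d₀ ∨ d = rev d₀ → ¬ (d' = d₀ ∨ d' = rev d₀) →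
        t ∈ Icc (0 : ℝ) 1 →
        _root_.replaceArc rev γ d₀ m d s = _root_.replaceArc rev γ d₀ m d' t →
        _root_.replaceArc rev γ d₀ m d' t ∈
          ⋃ d, γ d '' {t ∈ Icc (0 : ℝ) 1 | areaForm e (m - γ d₀ 0) (γ d t - γ d₀ 0) = 0} ∪
            γ d '' {t ∈ Icc (0 : ℝ) 1 |
              areaForm e (m - γ (rev d₀) 0) (γ d t - γ (rev d₀) 0) = 0} := by
      intro d d' s t hd hd' ht he
      rw [replaceArc_of_mem hd, replaceArc_of_notMem hd'] at he
      rw [replaceArc_of_notMem hd']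
      have hl := brokenArc_on_line e (γ d 0) m (γ (rev d) 0) s
      rw [he] at hl
      refine mem_iUnion.2 ⟨d', ?_⟩
      rcases hd with rfl | rfl
      · exact hl.imp (fun h0 => ⟨t, ⟨ht, h0⟩, rfl⟩) (fun h0 => ⟨t, ⟨ht, h0⟩, rfl⟩)
      · rw [hr.1] at hl
        exact hl.symm.imp (fun h0 => ⟨t, ⟨ht, h0⟩, rfl⟩) (fun h0 => ⟨t, ⟨ht, h0⟩, rfl⟩)
    refine (h.finite.union hfin).subset ?_
    rintro x ⟨d, d', s, hs, t, ht, h1, h2, hne⟩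
    by_cases hd : d = d₀ ∨ d = rev d₀ <;> by_cases hd' : d' = d₀ ∨ d' = rev d₀
    · exact absurd (same hd hd' (h1.trans h2.symm)) hne
    · exact Or.inr (h2 ▸ mem hd hd' (Ioo_subset_Icc_self ht) (h1.trans h2.symm))
    · exact Or.inr (h1 ▸ mem hd' hd (Ioo_subset_Icc_self hs) (h2.trans h1.symm))
    · rw [replaceArc_of_notMem hd] at h1
      rw [replaceArc_of_notMem hd'] at h2
      exact Or.inl ⟨d, d', s, hs, t, ht, h1, h2, hne⟩

/-- An arc with distinct end points can be replaced by the same broken arc in two systems. -/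
theorem exists_common_replaceArc [Finite D] (e : P ≃L[ℝ] ℝ × ℝ) (hr : IsPairing rev)
    {γ' : D → ℝ → P} (h : IsGenericSystem rev glue γ) (h' : IsGenericSystem rev glue γ')
    (h₀ : glue d₀ ≠ rev d₀) :
    ∃ m, IsGenericSystem rev glue (replaceArc rev γ d₀ m) ∧
      IsGenericSystem rev glue (replaceArc rev γ' d₀ m) := by
  -- Equal ends would force `rev d₀` to be `d₀` or `glue d₀`.
  have hne : ∀ {δ : D → ℝ → P}, IsGenericSystem rev glue δ → δ d₀ 0 ≠ δ (rev d₀) 0 :=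
    fun hδ he => ((hδ.joint _ _).1 he).elim (hr.2 d₀) (fun h1 => h₀ h1.symm)
  obtain ⟨x, h1, h2⟩ := ((h.ae_isGoodCorner (e := e) (hne h)).and
    (h'.ae_isGoodCorner (e := e) (hne h'))).exists
  exact ⟨e.symm x, h.replaceArc hr h1, h'.replaceArc hr h2⟩

end Replace

/-! ## Independence of the closure arcs -/

namespace LinkoidDiagram

variable {P : Type*} [NormedAddCommGroup P] [NormedSpace ℝ P] {n : ℕ} {τ : ClosurePerm n}

/-- Crossings of two strands are those of `L`; all others involve a closure arc. No point is of both
kinds, since it would be a triple point. -/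
theorem crossingData_closure (L : LinkoidDiagram P τ) {σ : ClosurePerm n}
    {arc : Fin (2 * n) → ℝ → P}
    (h : IsGenericSystem (closureRev τ σ) (closureGlue n) (Sum.elim L.strand arc)) :
    IsCrossingData (closureRev τ σ) (Sum.elim L.strand arc) L.classical
      {p | ∃ i d, IsCrossing (closureRev τ σ) (Sum.elim L.strand arc) (Sum.inr i) d p} := by
  have hL := L.crossingData
  have hiff : ∀ {i j : Fin (2 * n)} {p : P},
      IsCrossing (closureRev τ σ) (Sum.elim L.strand arc) (Sum.inl i) (Sum.inl j) p ↔
        IsCrossing τ.1 L.strand i j p := by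
    intro i j p
    simp only [IsCrossing, SpaceClosure.sameParam_inl_iff, Sum.elim_inl]
  refine ⟨?_, ?_, hL.over_unique, ?_⟩
  · intro p
    have hp := hL.crossing_iff p
    simp only [mem_empty_iff_false, or_false] at hp
    rw [← hp]
    constructor
    · rintro ⟨i | i, j | j, hc⟩
      · exact Or.inl ⟨i, j, hiff.1 hc⟩
      · obtain ⟨s, hs, t, ht, h1, h2, h3⟩ := hc
        exact Or.inr ⟨j, Sum.inl i, t, ht, s, hs, h2, h1,
          fun h4 => h3 (h4.symm (SpaceClosure.pairing_closureRev τ σ))⟩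
      · exact Or.inr ⟨i, _, hc⟩
      · exact Or.inr ⟨i, _, hc⟩
    · rintro (⟨i, j, hc⟩ | ⟨i, d, hc⟩)
      · exact ⟨_, _, hiff.2 hc⟩
      · exact ⟨_, _, hc⟩
  · rintro p ℓ hc ⟨k, -, u, hu, -, -, h3, -, -⟩
    obtain ⟨i, j, s, hs, t, ht, h1, h2, hne⟩ := (hL.crossing_iff p).2 (Or.inl ⟨ℓ, hc⟩)
    rcases h.no_triple (Sum.inl i) (Sum.inl j) (Sum.inr k) s hs t ht u hu (h1.trans h2.symm)
      (h1.trans h3.symm) with hd | hd | hd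
    · exact hne (SpaceClosure.sameParam_inl_iff.1 hd)
    · simp [SameParam] at hd
    · simp [SameParam] at hd
  · intro p ℓ hc
    obtain ⟨i, s, hs, h1, h2⟩ := hL.over_tangent p ℓ hc
    exact ⟨Sum.inl i, s, hs, h1, h2⟩

theorem isPresentation_closure (L : LinkoidDiagram P τ) {σ : ClosurePerm n}
    {arc : Fin (2 * n) → ℝ → P}
    (h : IsGenericSystem (closureRev τ σ) (closureGlue n) (Sum.elim L.strand arc)) :
    IsPresentation (closureRev τ σ) (closureGlue n) (Sum.elim L.strand arc)
      (⋃ d, Sum.elim L.strand arc d '' Icc 0 1) L.classical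
      {p | ∃ i d, IsCrossing (closureRev τ σ) (Sum.elim L.strand arc) (Sum.inr i) d p} :=
  ⟨SpaceClosure.pairing_closureRev τ σ, SpaceClosure.pairing_closureGlue n, h, rfl,
    L.crossingData_closure h⟩

/-- The closure diagram with given closure arcs. -/
def closure (L : LinkoidDiagram P τ) (σ : ClosurePerm n) (arc : Fin (2 * n) → ℝ → P)
    (h : IsGenericSystem (closureRev τ σ) (closureGlue n) (Sum.elim L.strand arc)) :
    VirtualDiagram P where
  carrier := ⋃ d, Sum.elim L.strand arc d '' Icc 0 1
  classical := L.classical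
  virt := {p | ∃ i d, IsCrossing (closureRev τ σ) (Sum.elim L.strand arc) (Sum.inr i) d p}
  exists_curves := ⟨_, inferInstance, _, _, _, L.isPresentation_closure h⟩

theorem IsClosureDiagram.eq_closure {L : LinkoidDiagram P τ} {σ : ClosurePerm n}
    {D : VirtualDiagram P} (hD : L.IsClosureDiagram σ D) : ∃ arc h, D = L.closure σ arc h := by
  obtain ⟨arc, h, hc, hcl, hv⟩ := hD
  refine ⟨arc, h, ?_⟩
  obtain ⟨C, X, V, _⟩ := D
  simp only at hc hcl hv
  subst hc hcl hv
  simp only [closure, iUnion_sum, Sum.elim_inl, Sum.elim_inr]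

theorem replaceArc_sumElim (L : LinkoidDiagram P τ) (σ : ClosurePerm n)
    (arc : Fin (2 * n) → ℝ → P) (i : Fin (2 * n)) (m : P) :
    replaceArc (closureRev τ σ) (Sum.elim L.strand arc) (Sum.inr i) m =
      Sum.elim L.strand (replaceArc σ.1 arc i m) := by
  funext d
  rcases d with d | d
  · simp [replaceArc]
  · simp [replaceArc]

variable (L : LinkoidDiagram P τ) {σ : ClosurePerm n} {arc arc' : Fin (2 * n) → ℝ → P}

/-- Any two choices of closure arcs thus have the same end points, so a common corner gives the same
broken arc. -/
theorem arc_zero_eq_strand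
    (h : IsGenericSystem (closureRev τ σ) (closureGlue n) (Sum.elim L.strand arc))
    (i : Fin (2 * n)) : arc i 0 = L.strand i 0 :=
  (h.joint (Sum.inr i) (Sum.inl i)).2 (Or.inr rfl)

/-- A single detour move: the strands, and with them the classical crossings, stay fixed, and every
crossing on a closure arc is virtual by construction. -/
theorem link_closure_eq_of_replaceArc {i : Fin (2 * n)} {m : P}
    (h : IsGenericSystem (closureRev τ σ) (closureGlue n) (Sum.elim L.strand arc))
    (h' : IsGenericSystem (closureRev τ σ) (closureGlue n)
      (Sum.elim L.strand (replaceArc σ.1 arc i m))) :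
    (L.closure σ arc h).link = (L.closure σ _ h').link := by
  refine Quot.sound (VirtualMove.detour ⟨_, inferInstance, _, _, _, _, Sum.inr i,
    L.isPresentation_closure h, L.isPresentation_closure h', ?_, ?_, ?_, rfl,
    fun d p hp => ⟨i, d, hp⟩, fun d p hp => ⟨i, d, hp⟩⟩)
  · rintro (d | d) h1 h2 t -
    · rfl
    · have hd : ¬ (d = i ∨ d = σ.1 i) := by
        rintro (rfl | rfl)
        · exact h1 rfl
        · exact h2 rfl
      rw [Sum.elim_inr, Sum.elim_inr, replaceArc_of_notMem hd]
  · exact replaceArc_zero i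
  · have h1 := h.reverse (Sum.inr i) 0 (left_mem_Icc.2 zero_le_one)
    simp only [Equiv.Perm.sumCongr_apply, Sum.map_inr, Sum.elim_inr, sub_zero] at h1
    rw [Sum.elim_inr, Sum.elim_inr, replaceArc_of_mem (Or.inl rfl), brokenArc_one, h1]

/-- Induction on the set `S` of labels at which the arcs may differ. Both families change in the
inductive step, so both are quantified inside the induction. -/
theorem link_closure_eq_of_eqOn_compl (e : P ≃L[ℝ] ℝ × ℝ) (S : Finset (Fin (2 * n))) :
    ∀ {arc arc' : Fin (2 * n) → ℝ → P}
      (h : IsGenericSystem (closureRev τ σ) (closureGlue n) (Sum.elim L.strand arc))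
      (h' : IsGenericSystem (closureRev τ σ) (closureGlue n) (Sum.elim L.strand arc')),
      (∀ i ∉ S, arc i = arc' i) → (L.closure σ arc h).link = (L.closure σ arc' h').link := by
  induction S using Finset.induction_on with
  | empty =>
    intro arc arc' h h' heq
    obtain rfl : arc = arc' := funext fun i => heq i (Finset.notMem_empty i)
    rfl
  | insert i S _ ih =>
    intro arc arc' h h' heq
    -- A closure arc is glued to a strand, never to its own reverse, so its ends are distinct.
    obtain ⟨m, hm, hm'⟩ := exists_common_replaceArc (d₀ := Sum.inr i) e
      (SpaceClosure.pairing_closureRev τ σ) h h' (by simp)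
    rw [replaceArc_sumElim] at hm hm'
    rw [L.link_closure_eq_of_replaceArc h hm, L.link_closure_eq_of_replaceArc h' hm']
    refine ih hm hm' fun k hk => ?_
    by_cases hki : k = i ∨ k = σ.1 i
    · rw [replaceArc_of_mem hki, replaceArc_of_mem hki]
      simp only [L.arc_zero_eq_strand h, L.arc_zero_eq_strand h']
    · rw [replaceArc_of_notMem hki, replaceArc_of_notMem hki]
      refine heq k fun hmem => ?_
      rcases Finset.mem_insert.1 hmem with h1 | h1
      · exact hki (Or.inl h1)
      · exact hk h1

/-- All closure diagrams of a linkoid diagram represent the same virtual link. -/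
theorem IsClosureDiagram.link_eq {L : LinkoidDiagram P τ} (e : P ≃L[ℝ] ℝ × ℝ)
    {D D' : VirtualDiagram P} (hD : L.IsClosureDiagram σ D) (hD' : L.IsClosureDiagram σ D') :
    D.link = D'.link := by
  obtain ⟨arc, h, rfl⟩ := hD.eq_closure
  obtain ⟨arc', h', rfl⟩ := hD'.eq_closure
  exact L.link_closure_eq_of_eqOn_compl e Finset.univ h h' fun i hi => absurd (Finset.mem_univ i) hi

end LinkoidDiagram

/-- Coordinates on the plane of projection. -/
theorem nonempty_planeCoordinates (ξ : Direction) : Nonempty (normalPlane ξ ≃L[ℝ] ℝ × ℝ) := by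
  have hξ : (ξ : Space) ≠ 0 := ne_zero_of_mem_unit_sphere ξ
  have : Fact (Module.finrank ℝ Space = 2 + 1) := ⟨by simp⟩
  have h := Submodule.finrank_orthogonal_span_singleton (𝕜 := ℝ) (n := 2) hξ
  exact ⟨ContinuousLinearEquiv.ofFinrankEq (by rw [h]; simp)⟩

theorem SpaceClosure.isClosureDiagram_projection {n : ℕ} {τ σ : ClosurePerm n} {L : OpenCurves τ}
    (K : SpaceClosure L σ) {ξ : Direction} (hL : L.IsRegular ξ) (hK : K.IsRegular ξ) :
    (L.projection ξ hL).IsClosureDiagram σ (K.projection ξ hK) := by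
  have hcurve : K.projCurve ξ =
      Sum.elim (L.projection ξ hL).strand (fun i t => projAlong ξ (K.arc i t)) := by
    funext d
    rcases d with d | d <;> rfl
  refine ⟨fun i t => projAlong ξ (K.arc i t), hcurve ▸ hK, ?_, rfl, ?_⟩
  · simp only [SpaceClosure.projection, iUnion_sum]
    rfl
  · rw [← hcurve]
    rfl

theorem corollary6p1 {n : ℕ} {τ σ : ClosurePerm n} (L : OpenCurves τ) (ξ : Direction)
    (hL : L.IsRegular ξ) (K : SpaceClosure L σ) (hK : K.IsRegular ξ) :
    (L.projection ξ hL).IsClosureDiagram σ (K.projection ξ hK) ∧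
      (L.projection ξ hL).IsVirtualClosure σ (K.projection ξ hK).link := by
  have h := K.isClosureDiagram_projection hL hK
  obtain ⟨e⟩ := nonempty_planeCoordinates ξ
  exact ⟨h, ⟨_, h, rfl⟩, fun D hD => hD.link_eq e h⟩
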